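/- **Setting.** Let $0<\epsilon<1$, $h\neq 0$, and let $f_0,f_1$ be probability densities on $\mathbb R$ with $\int x f_0(x)\,dx=0$ and $\int x f_1(x)\,dx=h$, such that $f=(1-\epsilon)f_0+\epsilon f_1$ is continuous. Let $x_1,x_2,\dots$ be random variables on a probability space with measure $\mathbf P_\epsilon$, each having density $f$, such that for some $T>0$ we have $\mathbf E_\epsilon e^{t x_i}<\infty$ for all $i$ and $|t|<T$ (Cramér's condition). Fix $0<\kappa<B$ and put $\mathbb B=[\kappa,B]$. Let $\theta_N=\frac1N\sum_{i\le N}x_i$ and, for $b\in\mathbb B$, $$\Psi_N(b)=\frac1{N^2}\Big(N_2(b)\sum_{i\le N,\,|x_i-\theta_N|<b}x_i-N_1(b)\sum_{i\le N,\,|x_i-\theta_N|\ge b}x_i\Big),$$ where $N_1(b)$ and $N_2(b)$ are the numbers of indices in the first and in the second sum. Put $$\Psi(b)=\int_{\epsilon h-b}^{\epsilon h+b}x f(x)\,dx-\epsilon h\int_{\epsilon h-b}^{\epsilon h+b}f(x)\,dx .$$ *$\psi$-mixing*: the coefficients $\psi(n)=\sup_{t\ge1}\sup_{A,D}\left|\frac{\mathbf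 P_\epsilon(A\cap D)}{\mathbf P_\epsilon(A)\mathbf P_\epsilon(D)}-1\right|$, over $A\in\sigma(x_i,\ i\le t)$ and $D\in\sigma(x_i,\ i\ge t+n)$ of positive probability, tend to $0$ as $n\to\infty$. *$\psi$-weak dependence* (with exponential rate): there are $\beta>0$ and a function $\psi(g,k,n,m)$ such that $$|\mathrm{Cov}(g(x_{i_1},\dots,x_{i_n}),k(x_{j_1},\dots,x_{j_m}))|\le\psi(g,k,n,m)e^{-\beta r}$$ for all $n,m\ge 1$, $r\ge 0$, all $i_1\le\dots\le i_n<i_n+r<j_1\le\dots\le j_m$ and all Lipschitz functions $g:\mathbb R^n\to\mathbb R$, $k:\mathbb R^m\to\mathbb R$ bounded by $1$, where $\psi(g,k,n,m)\le A\,[(1+n)(1+m)(1+\mathrm{Lip}\,g)(1+\mathrm{Lip}\,k)]^p$ for some constants $A,p$. **Theorem 2.** 1) If the sequence is $\psi$-mixing, then there are a constant $L_1>0$ and a positive function $L_2$ on $(0,\infty)$, not depending on $N$, such that for every $C$ with $0<C<\max_{b\in\mathbb B}|\Psi(b)|$ and every $N\ge1$ $$\mathbf P_\epsilon\Big\{\max_{b\in\mathbb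 B}|\Psi_N(b)|\le C\Big\}\le L_1\exp(-L_2(\delta)N),\qquad \delta=\max_{b\in\mathbb B}|\Psi(b)|-C .$$ 2) If the sequence is $\psi$-weakly dependent instead, the same holds with $L_1\exp(-L_2(\delta)\sqrt N)$ on the right-hand side. 3) Suppose that one of these two dependence conditions holds, that $0<\epsilon<1/2$, $h>0$, and that $f_1(x)=f_0(x-h)$ with $f_0$ continuous, so that $f(x)=(1-\epsilon)f_0(x)+\epsilon f_0(x-h)$. Suppose that the equation $f(\epsilon h-b)=f(\epsilon h+b)$ has exactly one root $b^*$ in $(0,\infty)$ and that $b^*\in\mathbb B$. Then, for any choice of $b_N^*\in\arg\max_{b\in\mathbb B}|\Psi_N(b)|$, we have $b_N^*\to b^*$ $\mathbf P_\epsilon$-a.s. as $N\to\infty$. Further, consider for given $(\theta,b)$ the equations for the unknown $(\epsilon',h')$ $$\epsilon' h'=\theta,\qquad \frac{1-\epsilon'}{\epsilon'}=\frac{f_0(\theta-b-h')-f_0(\theta+b-h')}{f_0(\theta+b)-f_0(\theta-b)}. \tag{S}$$ Let $f_0(\epsilon h+b^*)\ne f_0(\epsilon h-b^*)$, and let $\Theta\subseteq(0,\tfrac12)\times(0,\infty)$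 be a set of admissible parameters in which (S) with $(\theta,b)=(\epsilon h,b^*)$ has no solution other than $(\epsilon,h)$. If the estimates $(\hat\epsilon_N,\hat h_N)$ are such that, almost surely, for all sufficiently large $N$ they solve (S) with $(\theta,b)=(\theta_N,b_N^*)$ and remain in a compact subset of $\Theta$ (which may depend on the outcome), then $\hat\epsilon_N\to\epsilon$ and $\hat h_N\to h$ $\mathbf P_\epsilon$-a.s. as $N\to\infty$. -/

import Mathlib

open MeasureTheory ProbabilityTheory Filter Topology Set
open scoped ENNReal

noncomputable section

namespace Contam

/-! ### The statistic, as a function of a sample `x 0, …, x (N - 1)` -/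

/-- The sample mean `θ_N`. -/
def sampleMean (x : ℕ → ℝ) (N : ℕ) : ℝ := (1 / (N : ℝ)) * ∑ i ∈ Finset.range N, x i

/-- Indices of the observations classified as ordinary: `|x_i - θ_N| < b`. -/
def ordinary (x : ℕ → ℝ) (N : ℕ) (b : ℝ) : Finset ℕ :=
  open Classical in (Finset.range N).filter fun i => |x i - sampleMean x N| < b

/-- Indices of the observations classified as abnormal: `|x_i - θ_N| ≥ b`. -/
def abnormal (x : ℕ → ℝ) (N : ℕ) (b : ℝ) : Finset ℕ :=
  open Classical in (Finset.range N).filter fun i => b ≤ |x i - sampleMean x N|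

/-- The decision statistic `Ψ_N(b) = N⁻² (N₂ ∑ ordinary - N₁ ∑ abnormal)`. -/
def PsiN (x : ℕ → ℝ) (N : ℕ) (b : ℝ) : ℝ :=
  (1 / (N : ℝ) ^ 2) *
    (((abnormal x N b).card : ℝ) * ∑ i ∈ ordinary x N b, x i
      - ((ordinary x N b).card : ℝ) * ∑ i ∈ abnormal x N b, x i)

/-- `max_{b ∈ [κ, B]} |g b|`; all functions `g` used below are bounded and attain it. -/
def maxAbs (g : ℝ → ℝ) (κ B : ℝ) : ℝ := sSup ((fun b => |g b|) '' Icc κ B)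

/-! ### Densities and the limit function -/

/-- `f` is a probability density on the real line. -/
def IsDensity (f : ℝ → ℝ) : Prop :=
  Measurable f ∧ (∀ x, 0 ≤ f x) ∧ ∫⁻ x, ENNReal.ofReal (f x) = 1

/-- The mixture density `(1 - ε) f₀ + ε f₁`. -/
def mixture (ε : ℝ) (f₀ f₁ : ℝ → ℝ) (x : ℝ) : ℝ := (1 - ε) * f₀ x + ε * f₁ x

/-- `r(b)`, for the centre `m`. -/
def rFun (f : ℝ → ℝ) (m b : ℝ) : ℝ := ∫ x in (m - b)..(m + b), f x * x

/-- `d(b)`, for the centre `m`. -/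
def dFun (f : ℝ → ℝ) (m b : ℝ) : ℝ := ∫ x in (m - b)..(m + b), f x

/-- `Ψ(b) = r(b) - m d(b)`, for the centre `m`. -/
def PsiLim (f : ℝ → ℝ) (m b : ℝ) : ℝ := rFun f m b - m * dFun f m b

/-! ### Dependence and moment conditions -/

variable {Ω : Type*} [MeasurableSpace Ω]

/-- The `ψ`-measure of dependence between two σ-algebras (it may be infinite). -/
def psiDep (P : Measure Ω) (H₁ H₂ : MeasurableSpace Ω) : ℝ≥0∞ :=
  ⨆ (A : Set Ω) (B : Set Ω) (_ : MeasurableSet[H₁] A) (_ : MeasurableSet[H₂] B)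
    (_ : P.real A * P.real B ≠ 0),
    ENNReal.ofReal |P.real (A ∩ B) / (P.real A * P.real B) - 1|

/-- The σ-algebra generated by the variables `X i` with `i ∈ S`. -/
@[reducible] def sigmaOf (X : ℕ → Ω → ℝ) (S : Set ℕ) : MeasurableSpace Ω :=
  ⨆ i ∈ S, MeasurableSpace.comap (X i) inferInstance

/-- The `ψ`-mixing coefficient `ψ(n) = sup_t ψ(σ(X_i, i ≤ t), σ(X_i, i ≥ t + n))`. -/
def psiCoeff (P : Measure Ω) (X : ℕ → Ω → ℝ) (n : ℕ) : ℝ≥0∞ :=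
  ⨆ t : ℕ, psiDep P (sigmaOf X (Iic t)) (sigmaOf X (Ici (t + n)))

/-- The `ψ`-mixing condition. -/
def PsiMixing (P : Measure Ω) (X : ℕ → Ω → ℝ) : Prop :=
  Tendsto (psiCoeff P X) atTop (𝓝 0)

/-- `(θ, 𝓛, ψ)`-weak dependence: the covariance of `f(X_{i_1}, …, X_{i_n})` and
`h(X_{j_1}, …, X_{j_m})`, where `i_1 ≤ … ≤ i_n < i_n + r < j_1 ≤ … ≤ j_m`, is at most
`ψ(f, h, n, m) θ_r`. -/
def WeakDependent (P : Measure Ω) (X : ℕ → Ω → ℝ) (θ : ℕ → ℝ)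
    (𝓛 : (n : ℕ) → Set ((Fin n → ℝ) → ℝ))
    (ψ : (n m : ℕ) → ((Fin n → ℝ) → ℝ) → ((Fin m → ℝ) → ℝ) → ℝ) : Prop :=
  ∀ (n m r : ℕ), 1 ≤ n → 1 ≤ m →
    ∀ (i : Fin n → ℕ) (j : Fin m → ℕ), Monotone i → Monotone j →
      (∀ a b, i a + r < j b) →
      ∀ f ∈ 𝓛 n, ∀ h ∈ 𝓛 m,
        |covariance (fun ω => f fun a => X (i a) ω) (fun ω => h fun b => X (j b) ω) P|
          ≤ ψ n m f h * θ r

/-- `L` is a Lipschitz constant of `f` for the `ℓ¹` norm. -/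
def IsLipConst {n : ℕ} (f : (Fin n → ℝ) → ℝ) (L : ℝ) : Prop :=
  0 ≤ L ∧ ∀ x y, |f x - f y| ≤ L * ∑ a, |x a - y a|

/-- The Lipschitz modulus of `f` (used for Lipschitz `f` only). -/
def lipMod {n : ℕ} (f : (Fin n → ℝ) → ℝ) : ℝ := sInf {L | IsLipConst f L}

/-- Lipschitz functions of `n` real variables that are bounded by one. -/
def boundedLip (n : ℕ) : Set ((Fin n → ℝ) → ℝ) :=
  {f | (∀ x, |f x| ≤ 1) ∧ ∃ L, IsLipConst f L}

/-- `ψ`-weak dependence with exponentially decreasing `θ_r = exp (-β r)`, over the bounded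
Lipschitz functions, where `ψ(f, h, n, m)` is any function that grows at most polynomially in
`n`, `m` and the Lipschitz moduli of `f` and `h`. -/
def PsiWeakDependent (P : Measure Ω) (X : ℕ → Ω → ℝ) : Prop :=
  ∃ (β : ℝ) (ψ : (n m : ℕ) → ((Fin n → ℝ) → ℝ) → ((Fin m → ℝ) → ℝ) → ℝ),
    0 < β ∧
    (∃ (A : ℝ) (p : ℕ), ∀ n m : ℕ, ∀ f ∈ boundedLip n, ∀ h ∈ boundedLip m,
      ψ n m f h ≤ A * ((1 + n) * (1 + m) * (1 + lipMod f) * (1 + lipMod h)) ^ p) ∧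
    WeakDependent P X (fun r => Real.exp (-β * r)) boundedLip ψ

/-- The uniform Cramer condition. -/
def UniformCramer (P : Measure Ω) (X : ℕ → Ω → ℝ) : Prop :=
  ∃ T : ℝ, 0 < T ∧ ∀ (i : ℕ) (t : ℝ), |t| < T → Integrable (fun ω => Real.exp (t * X i ω)) P

/-! ### Estimation of the parameters -/

/-- The pair `q = (ε', h')` solves the estimating equations with data `θ` and `b`. For
`0 < ε' < 1` the second equation forces the denominator on its right-hand side to be nonzero. -/
def EstimatingEq (f₀ : ℝ → ℝ) (θ b : ℝ) (q : ℝ × ℝ) : Prop :=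
  q.1 * q.2 = θ ∧
    (1 - q.1) / q.1
      = (f₀ (θ - b - q.2) - f₀ (θ + b - q.2)) / (f₀ (θ + b) - f₀ (θ - b))

end Contam

end

/-! # Exponential bounds and consistency for the contamination statistic

Write `m = ε h` for the mean of the common law `μ` of the observations, and `window b u` for `u`
if `|u| < b` and `0` otherwise. Since the two groups exhaust the sample, `Ψ_N(b)` is the
empirical mean of `window b (x_i - θ_N)` (`PsiN_eq`), and `Ψ(b)` is `∫ window b (x - m) dμ`.
So everything follows from a law of large numbers with exponentially small exceptional
probabilities, at rate `N` or `√N`.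

*Concentration.* It is enough to control upper deviations of the means of nonnegative Lipschitz
functions `w` with an exponential moment (`UpperConcentration`). The indices are split into
residue classes. Under `ψ`-mixing the modulus is a fixed large number, and along a class the
exponential moments multiply up to a factor `1 + ψ` per index, which is absorbed by the gap
between `E exp (t w)` and `exp (t (E w + η))` (`upperConcentration_of_psiMixing`). Under weak
dependence the modulus is about `√N`, as is the size of each class. Here `exp (t ∑ w)` is replaced
by `exp (t (min (∑ w) c))` with the threshold `c` of the deviation: this is still submultiplicative
for `w ≥ 0`, it is Lipschitz, and it is bounded by `exp (t c) = exp (O(t √N))`, so that for small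
`t` the covariance bound `exp (-β √N)` wins, even for unbounded `w`
(`upperConcentration_of_psiWeakDependent`).

*Uniformity.* Moving the centre or the width of a window changes `window` only slightly, except
near its edges, where a Lipschitz bump of small integral dominates the change. This makes `Ψ_N`
uniformly close to `Ψ` near each `b`, hence on `[κ, B]` by compactness
(`UpperConcentration.expRare_uniform`). The bound on the type 2 error follows
(`exists_typeTwoError_le`).

*Consistency.* By Borel–Cantelli the convergence `Ψ_N → Ψ` is almost surely uniform. As
`Ψ' (b) = b (f (m + b) - f (m - b))`, `Ψ 0 = 0` and `Ψ b → 0` as `b → ∞`, a unique root of the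
balancing equation is the strict maximizer of `|Ψ|` (`abs_lt_abs_of_unique_critical`), so maximizers
converge to it. Cluster points of the estimates of `(ε, h)` solve the limiting equations, whose
solution is unique (`tendsto_of_estimatingEq`).
-/

namespace Contam

/-! ### Exponentially rare events -/

section Rare

variable {Ω : Type*} [MeasurableSpace Ω] {P : Measure Ω} {r : ℕ → ℝ}

/-- The events `E N`, `N ≥ 1`, are exponentially rare at rate `r`: `P (E N) ≤ L exp (-c r N)` for
some constants `L, c > 0`. -/
def ExpRare (P : Measure Ω) (r : ℕ → ℝ) (E : ℕ → Set Ω) : Prop :=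
  ∃ L c : ℝ, 0 < L ∧ 0 < c ∧ ∀ N : ℕ, 1 ≤ N → P.real (E N) ≤ L * Real.exp (-c * r N)

lemma ExpRare.mono [IsFiniteMeasure P] {E F : ℕ → Set Ω} (hF : ExpRare P r F)
    (h : ∀ N, 1 ≤ N → E N ⊆ F N) : ExpRare P r E := by
  obtain ⟨L, c, hL, hc, hb⟩ := hF
  exact ⟨L, c, hL, hc, fun N hN => (measureReal_mono (h N hN)).trans (hb N hN)⟩

lemma ExpRare.union [IsFiniteMeasure P] (hr : ∀ N, 0 ≤ r N) {E F : ℕ → Set Ω}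
    (hE : ExpRare P r E) (hF : ExpRare P r F) : ExpRare P r (fun N => E N ∪ F N) := by
  obtain ⟨L, c, hL, hc, hb⟩ := hE
  obtain ⟨L', c', hL', hc', hb'⟩ := hF
  refine ⟨L + L', min c c', by positivity, lt_min hc hc', fun N hN => ?_⟩
  refine (measureReal_union_le _ _).trans ?_
  have h1 : Real.exp (-c * r N) ≤ Real.exp (-(min c c') * r N) := by
    gcongr
    · exact hr N
    · exact min_le_left _ _
  have h2 : Real.exp (-c' * r N) ≤ Real.exp (-(min c c') * r N) := by
    gcongr
    · exact hr N
    · exact min_le_right _ _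
  have h3 := mul_le_mul_of_nonneg_left h1 hL.le
  have h4 := mul_le_mul_of_nonneg_left h2 hL'.le
  linarith [hb N hN, hb' N hN]

lemma ExpRare.biUnion [IsFiniteMeasure P] (hr : ∀ N, 0 ≤ r N) {ι : Type*} (s : Finset ι)
    {E : ι → ℕ → Set Ω} (hE : ∀ i ∈ s, ExpRare P r (E i)) :
    ExpRare P r (fun N => ⋃ i ∈ s, E i N) := by
  classical
  induction s using Finset.induction_on with
  | empty => exact ⟨1, 1, one_pos, one_pos, fun N _ => by simp; positivity⟩
  | insert a s _ ih =>
    have h := (hE a (Finset.mem_insert_self a s)).union hr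
      (ih fun i hi => hE i (Finset.mem_insert_of_mem hi))
    exact h.mono fun N _ => by rw [Finset.set_biUnion_insert]

/-- Since probabilities are at most one, the constant in front of the exponential can be taken
to be `2`, at the expense of the exponent. -/
lemma ExpRare.exists_two_mul [IsProbabilityMeasure P] {E : ℕ → Set Ω} (hE : ExpRare P r E) :
    ∃ c : ℝ, 0 < c ∧ ∀ N : ℕ, 1 ≤ N → P.real (E N) ≤ 2 * Real.exp (-c * r N) := by
  obtain ⟨L, c, hL, hc, hb⟩ := hE
  set a := Real.log (max L 2) with ha
  have h2a : Real.log 2 ≤ a := Real.log_le_log two_pos (le_max_right _ _)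
  have hlog : 0 < Real.log 2 := Real.log_pos one_lt_two
  have ha0 : 0 < a := hlog.trans_le h2a
  set s := Real.log 2 / a with hs
  have hs0 : 0 < s := div_pos hlog ha0
  have hs1 : s ≤ 1 := (div_le_one ha0).2 h2a
  refine ⟨s * c, by positivity, fun N hN => ?_⟩
  -- `min 1 (exp y) ≤ exp (s y)` for `0 < s ≤ 1`
  have hy : P.real (E N) ≤ Real.exp (a - c * r N) := by
    refine (hb N hN).trans ?_
    rw [sub_eq_add_neg, Real.exp_add, ha, Real.exp_log (by positivity), neg_mul]
    gcongr
    exact le_max_left _ _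
  have key : P.real (E N) ≤ Real.exp (s * (a - c * r N)) := by
    rcases le_total (a - c * r N) 0 with h | h
    · refine hy.trans (Real.exp_le_exp.2 ?_)
      nlinarith
    · exact measureReal_le_one.trans (Real.one_le_exp (by positivity))
  refine key.trans (le_of_eq ?_)
  have : s * (a - c * r N) = Real.log 2 + -(s * c) * r N := by
    have : s * a = Real.log 2 := by rw [hs]; field_simp
    linear_combination this
  rw [this, Real.exp_add, Real.exp_log two_pos]

lemma summable_exp_neg_mul_sqrt {c : ℝ} (hc : 0 < c) :
    Summable fun N : ℕ => Real.exp (-c * √(N : ℝ)) := by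
  have hlim : Tendsto (fun N : ℕ => √(N : ℝ)) atTop atTop :=
    Real.tendsto_sqrt_atTop.comp tendsto_natCast_atTop_atTop
  have h1 := (isLittleO_exp_neg_mul_rpow_atTop hc (-4)).comp_tendsto hlim
  refine summable_of_isBigO_nat (g := fun N : ℕ => 1 / (N : ℝ) ^ 2)
    (Real.summable_one_div_nat_pow.2 one_lt_two) ?_
  refine h1.isBigO.congr' (Eventually.of_forall fun N => rfl) ?_
  filter_upwards [eventually_gt_atTop 0] with N hN
  have hN' : (0 : ℝ) < N := by exact_mod_cast hN
  have h4 : √(N : ℝ) ^ (4 : ℕ) = (N : ℝ) ^ 2 := by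
    rw [show 4 = 2 * 2 from rfl, pow_mul, Real.sq_sqrt hN'.le]
  simp only [Function.comp]
  rw [Real.rpow_neg (Real.sqrt_nonneg _), one_div, ← h4]
  norm_cast

/-- The Borel–Cantelli lemma for exponentially rare events. -/
lemma ExpRare.ae_eventually_notMem [IsFiniteMeasure P] (hr : ∀ N : ℕ, √(N : ℝ) ≤ r N)
    {E : ℕ → Set Ω} (hE : ExpRare P r E) : ∀ᵐ ω ∂P, ∀ᶠ N in atTop, ω ∉ E N := by
  obtain ⟨L, c, hL, hc, hb⟩ := hE
  have hsum : Summable fun N : ℕ => P.real (E N) := by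
    refine Summable.of_norm_bounded_eventually_nat
      (g := fun N : ℕ => L * Real.exp (-c * √(N : ℝ))) ((summable_exp_neg_mul_sqrt hc).mul_left L) ?_
    filter_upwards [eventually_ge_atTop 1] with N hN
    rw [Real.norm_of_nonneg measureReal_nonneg]
    refine (hb N hN).trans ?_
    gcongr ?_ * Real.exp ?_
    nlinarith [hr N]
  have hne : ∑' N, P (E N) ≠ ∞ := by
    have h := hsum.tsum_ofReal_ne_top
    simpa [ofReal_measureReal] using h
  exact MeasureTheory.ae_eventually_notMem hne

end Rare

/-! ### Exponential moments -/

section Chernoff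

/-- For `w ≥ 0` with an exponential moment, `E exp (t w) < exp (t (E w + η))` for all small
`t > 0`, because the derivative of the left-hand side at `t = 0` is `E w`. -/
lemma exists_mgf_lt {μ : Measure ℝ} [IsProbabilityMeasure μ] {w : ℝ → ℝ} (hw : Measurable w)
    (h0 : ∀ x, 0 ≤ w x) {t₀ : ℝ} (ht₀ : 0 < t₀)
    (hint : Integrable (fun x => Real.exp (t₀ * w x)) μ) {η : ℝ} (hη : 0 < η) {τ : ℝ}
    (hτ : 0 < τ) :
    ∃ t, 0 < t ∧ t < τ ∧ t < t₀ ∧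
      ∫ x, Real.exp (t * w x) ∂μ < Real.exp (t * (∫ x, w x ∂μ + η)) := by
  have hset : Iic t₀ ⊆ integrableExpSet w μ := by
    intro s hs
    refine hint.mono' (by fun_prop) (ae_of_all _ fun x => ?_)
    rw [Real.norm_of_nonneg (Real.exp_pos _).le]
    exact Real.exp_le_exp.2 (mul_le_mul_of_nonneg_right hs (h0 x))
  have hmem : (0 : ℝ) ∈ interior (integrableExpSet w μ) :=
    mem_interior_iff_mem_nhds.2 (mem_of_superset (Iic_mem_nhds ht₀) hset)
  have hd := hasDerivAt_mgf hmem
  simp only [zero_mul, Real.exp_zero, mul_one] at hd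
  have hd2 : HasDerivAt (fun t => Real.exp (t * (∫ x, w x ∂μ + η))) (∫ x, w x ∂μ + η) 0 := by
    have := ((hasDerivAt_id (0 : ℝ)).mul_const (∫ x, w x ∂μ + η)).exp
    simpa using this
  have hF : HasDerivAt (fun t => Real.exp (t * (∫ x, w x ∂μ + η)) - mgf w μ t) η 0 := by
    have h := hd2.sub hd
    rw [add_sub_cancel_left] at h
    exact h
  have hpos : ∀ᶠ t in 𝓝[>] (0 : ℝ),
      0 < Real.exp (t * (∫ x, w x ∂μ + η)) - mgf w μ t := by
    have hsl := (hasDerivAt_iff_tendsto_slope.1 hF).mono_left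
      (nhdsWithin_mono 0 (fun x (hx : x ∈ Ioi (0 : ℝ)) => (ne_of_gt hx : x ≠ 0)))
    filter_upwards [hsl.eventually (lt_mem_nhds hη), self_mem_nhdsWithin] with t ht ht0
    have ht0' : (0 : ℝ) < t := ht0
    simp only [slope_def_field, zero_mul, Real.exp_zero, mgf_zero, sub_self, sub_zero] at ht
    exact (div_pos_iff_of_pos_right ht0').1 ht
  have hlt : ∀ᶠ t in 𝓝[>] (0 : ℝ), 0 < t ∧ t < τ ∧ t < t₀ := by
    filter_upwards [Ioo_mem_nhdsGT hτ, Ioo_mem_nhdsGT ht₀] with t h1 h2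
    exact ⟨h1.1, h1.2, h2.2⟩
  obtain ⟨t, ht, h1, h2, h3⟩ := (hpos.and hlt).exists
  exact ⟨t, h1, h2, h3, by simpa [mgf] using sub_pos.1 ht⟩

lemma one_le_integral_exp {μ : Measure ℝ} [IsProbabilityMeasure μ] {w : ℝ → ℝ}
    (h0 : ∀ x, 0 ≤ w x) {t : ℝ} (ht : 0 ≤ t)
    (hint : Integrable (fun x => Real.exp (t * w x)) μ) :
    1 ≤ ∫ x, Real.exp (t * w x) ∂μ := by
  have h : ∫ _, (1 : ℝ) ∂μ ≤ ∫ x, Real.exp (t * w x) ∂μ :=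
    integral_mono (integrable_const _) hint fun x => Real.one_le_exp (mul_nonneg ht (h0 x))
  simpa using h

lemma integrable_exp_mul_of_le {μ : Measure ℝ} {w : ℝ → ℝ} (hw : Measurable w)
    (h0 : ∀ x, 0 ≤ w x) {t t₀ : ℝ} (ht : t ≤ t₀)
    (hint : Integrable (fun x => Real.exp (t₀ * w x)) μ) :
    Integrable (fun x => Real.exp (t * w x)) μ := by
  refine hint.mono' (by fun_prop) (ae_of_all _ fun x => ?_)
  rw [Real.norm_of_nonneg (Real.exp_pos _).le]
  exact Real.exp_le_exp.2 (mul_le_mul_of_nonneg_right ht (h0 x))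

end Chernoff

/-! ### Residue classes of indices -/

section Residues

/-- The indices below `N` in the residue class of `k` modulo `n`. -/
def residueClass (N n k : ℕ) : Finset ℕ := {i ∈ Finset.range N | i % n = k}

lemma residueClass_gap {N n k i j : ℕ} (hi : i ∈ residueClass N n k)
    (hj : j ∈ residueClass N n k) (hij : i < j) : i + n ≤ j := by
  simp only [residueClass, Finset.mem_filter] at hi hj
  exact Nat.ModEq.add_le_of_lt (hi.2.trans hj.2.symm) hij

lemma card_residueClass_le (N n k : ℕ) : (residueClass N n k).card ≤ N / n + 1 := by
  have h : (residueClass N n k).card ≤ (Finset.range (N / n + 1)).card := by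
    refine Finset.card_le_card_of_injOn (fun i => i / n) (fun i hi => ?_) (fun i hi j hj hij => ?_)
    · simp only [residueClass, Finset.coe_filter, Finset.mem_range, mem_ofPred_eq] at hi
      simpa using Nat.lt_succ_of_le (Nat.div_le_div_right hi.1.le)
    · simp only [residueClass, Finset.coe_filter, Finset.mem_range, mem_ofPred_eq] at hi hj
      rw [← Nat.div_add_mod i n, ← Nat.div_add_mod j n, hi.2, hj.2]
      simp only at hij
      rw [hij]
  simpa using h

/-- If a sum over `N` indices is at least `N a`, then so is, on average, the sum over one of the
residue classes modulo `n`. -/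
lemma measureReal_sum_ge_le {Ω : Type*} [MeasurableSpace Ω] (P : Measure Ω) [IsFiniteMeasure P]
    (Y : ℕ → Ω → ℝ) (N : ℕ) {n : ℕ} (hn : 0 < n) (a : ℝ) :
    P.real {ω | N * a ≤ ∑ i ∈ Finset.range N, Y i ω}
      ≤ ∑ k ∈ Finset.range n, P.real {ω | N / n * a ≤ ∑ i ∈ residueClass N n k, Y i ω} := by
  refine (measureReal_mono (s₂ := ⋃ k ∈ Finset.range n,
    {ω | N / n * a ≤ ∑ i ∈ residueClass N n k, Y i ω}) (fun ω hω => ?_)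
    (measure_ne_top _ _)).trans (measureReal_biUnion_finset_le _ _)
  have hsum : ∑ k ∈ Finset.range n, ∑ i ∈ residueClass N n k, Y i ω
      = ∑ i ∈ Finset.range N, Y i ω :=
    Finset.sum_fiberwise_of_maps_to (fun i _ => Finset.mem_range.2 (Nat.mod_lt i hn)) _
  have hn' : (n : ℝ) ≠ 0 := by exact_mod_cast hn.ne'
  have hle : ∑ _k ∈ Finset.range n, (N / n * a : ℝ)
      ≤ ∑ k ∈ Finset.range n, ∑ i ∈ residueClass N n k, Y i ω := by
    rw [hsum, Finset.sum_const, Finset.card_range, nsmul_eq_mul]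
    refine le_trans (le_of_eq ?_) hω
    field_simp
  obtain ⟨k, hk, hle⟩ := Finset.exists_le_of_sum_le (by simpa using hn.ne') hle
  exact mem_biUnion hk hle

end Residues

/-! ### The concentration property -/

/-- Upper deviations of empirical means of the variables `X i`, with common law `μ`, are
exponentially rare at rate `r`: for each nonnegative Lipschitz function `w` with an exponential
moment and each `η > 0`, the event `∑ i < N, w (X i) ≥ N (E w + η)` is. -/
def UpperConcentration {Ω : Type*} [MeasurableSpace Ω] (P : Measure Ω) (X : ℕ → Ω → ℝ)
    (μ : Measure ℝ) (r : ℕ → ℝ) : Prop :=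
  ∀ (w : ℝ → ℝ) (K : NNReal), LipschitzWith K w → (∀ x, 0 ≤ w x) →
    ∀ t₀ : ℝ, 0 < t₀ → Integrable (fun x => Real.exp (t₀ * w x)) μ →
      ∀ η : ℝ, 0 < η →
        ExpRare P r fun N => {ω | N * (∫ x, w x ∂μ + η) ≤ ∑ i ∈ Finset.range N, w (X i ω)}

/-! ### Concentration under mixing -/

section Mixing

lemma measure_inter_le_of_psiDep_le {Ω : Type*} {H₁ H₂ mΩ : MeasurableSpace Ω} {P : Measure Ω}
    [IsFiniteMeasure P] {c : ℝ}
    (hc : 0 ≤ c) (h : psiDep P H₁ H₂ ≤ ENNReal.ofReal c) {A D : Set Ω}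
    (hA : MeasurableSet[H₁] A) (hD : MeasurableSet[H₂] D) :
    P (A ∩ D) ≤ ENNReal.ofReal (1 + c) * (P A * P D) := by
  have key : P.real (A ∩ D) ≤ (1 + c) * (P.real A * P.real D) := by
    by_cases h0 : P.real A * P.real D = 0
    · have : P.real (A ∩ D) ≤ 0 := by
        rcases mul_eq_zero.1 h0 with h1 | h1
        · exact h1 ▸ measureReal_mono inter_subset_left
        · exact h1 ▸ measureReal_mono inter_subset_right
      rw [h0, mul_zero]
      exact this
    · have h1 : ENNReal.ofReal |P.real (A ∩ D) / (P.real A * P.real D) - 1|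
          ≤ ENNReal.ofReal c := by
        refine le_trans ?_ h
        unfold psiDep
        exact le_iSup_of_le A (le_iSup_of_le D (le_iSup_of_le hA (le_iSup_of_le hD
          (le_iSup_of_le h0 le_rfl))))
      have h2 := (le_abs_self _).trans ((ENNReal.ofReal_le_ofReal_iff hc).1 h1)
      have hpos : 0 < P.real A * P.real D :=
        lt_of_le_of_ne (mul_nonneg measureReal_nonneg measureReal_nonneg) (Ne.symm h0)
      exact (div_le_iff₀ hpos).1 (by linarith)
  rw [← ofReal_measureReal (μ := P) (s := A), ← ofReal_measureReal (μ := P) (s := D),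
    ← ofReal_measureReal (μ := P) (s := A ∩ D), ← ENNReal.ofReal_mul measureReal_nonneg,
    ← ENNReal.ofReal_mul (by linarith)]
  exact ENNReal.ofReal_le_ofReal key

/-- A bound `P (A ∩ D) ≤ K P A P D` for the events of two σ-algebras extends to products of
nonnegative functions that are measurable for them. -/
lemma lintegral_mul_le_of_measure_inter_le {Ω : Type*} {H₁ H₂ mΩ : MeasurableSpace Ω}
    {P : Measure Ω} (hH₁ : H₁ ≤ mΩ) (hH₂ : H₂ ≤ mΩ) {K : ℝ≥0∞}
    (h : ∀ A D, MeasurableSet[H₁] A → MeasurableSet[H₂] D → P (A ∩ D) ≤ K * (P A * P D))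
    {U V : Ω → ℝ≥0∞} (hU : Measurable[H₁] U) (hV : Measurable[H₂] V) :
    ∫⁻ ω, U ω * V ω ∂P ≤ K * ((∫⁻ ω, U ω ∂P) * ∫⁻ ω, V ω ∂P) := by
  have hV' : Measurable V := hV.mono hH₂ le_rfl
  have hU' : Measurable U := hU.mono hH₁ le_rfl
  have h1 : ∀ A, MeasurableSet[H₁] A → ∫⁻ ω in A, V ω ∂P ≤ K * P A * ∫⁻ ω, V ω ∂P := by
    intro A hA
    have hle : (P.restrict A).trim hH₂ ≤ (K * P A) • P.trim hH₂ := by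
      refine Measure.le_iff.2 fun D hD => ?_
      rw [Measure.smul_apply, trim_measurableSet_eq hH₂ hD, trim_measurableSet_eq hH₂ hD,
        Measure.restrict_apply (hH₂ D hD), inter_comm, smul_eq_mul, mul_assoc]
      exact h A D hA hD
    have h2 := lintegral_mono' hle (le_refl V)
    rwa [lintegral_smul_measure, lintegral_trim hH₂ hV, lintegral_trim hH₂ hV] at h2
  have hle : (P.withDensity V).trim hH₁ ≤ (K * ∫⁻ ω, V ω ∂P) • P.trim hH₁ := by
    refine Measure.le_iff.2 fun A hA => ?_
    rw [Measure.smul_apply, trim_measurableSet_eq hH₁ hA, trim_measurableSet_eq hH₁ hA,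
      withDensity_apply _ (hH₁ A hA), smul_eq_mul]
    exact (h1 A hA).trans (le_of_eq (by ring))
  have h2 := lintegral_mono' hle (le_refl U)
  rw [lintegral_smul_measure, lintegral_trim hH₁ hU, lintegral_trim hH₁ hU,
    lintegral_withDensity_eq_lintegral_mul _ hV' hU'] at h2
  calc ∫⁻ ω, U ω * V ω ∂P = ∫⁻ ω, (V * U) ω ∂P := by simp only [Pi.mul_apply, mul_comm]
    _ ≤ _ := h2
    _ = _ := by rw [smul_eq_mul]; ring

variable {Ω : Type*}

lemma measurable_sigmaOf (X : ℕ → Ω → ℝ) {S : Set ℕ} {i : ℕ} (hi : i ∈ S) :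
    Measurable[sigmaOf X S] (X i) := by
  rw [measurable_iff_comap_le]
  exact le_iSup₂ (f := fun i (_ : i ∈ S) => MeasurableSpace.comap (X i) inferInstance) i hi

variable [mΩ : MeasurableSpace Ω] {P : Measure Ω}

lemma sigmaOf_le {X : ℕ → Ω → ℝ} (hX : ∀ i, Measurable (X i)) (S : Set ℕ) : sigmaOf X S ≤ mΩ :=
  iSup₂_le fun i _ => (hX i).comap_le

/-- Under `ψ`-mixing, a product over indices that are `n` apart is almost independent. -/
lemma lintegral_prod_le_of_psiCoeff_le [IsProbabilityMeasure P] {X : ℕ → Ω → ℝ}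
    (hX : ∀ i, Measurable (X i)) {μ : Measure ℝ} (hμ : ∀ i, P.map (X i) = μ) {c : ℝ}
    (hc : 0 ≤ c) {n : ℕ} (hn : psiCoeff P X n ≤ ENNReal.ofReal c) {F : ℝ → ℝ≥0∞}
    (hF : Measurable F) (s : Finset ℕ) (hs : ∀ i ∈ s, ∀ j ∈ s, i < j → i + n ≤ j) :
    ∫⁻ ω, ∏ i ∈ s, F (X i ω) ∂P ≤ (ENNReal.ofReal (1 + c) * ∫⁻ x, F x ∂μ) ^ s.card := by
  induction s using Finset.induction_on_max with
  | empty => simp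
  | insert a s ha ih =>
    have has : a ∉ s := fun h => lt_irrefl _ (ha a h)
    have hone : ∫⁻ ω, F (X a ω) ∂P = ∫⁻ x, F x ∂μ := by
      rw [← hμ a, lintegral_map hF (hX a)]
    have ih' := ih fun i hi j hj => hs i (Finset.mem_insert_of_mem hi) j
      (Finset.mem_insert_of_mem hj)
    rw [Finset.card_insert_of_notMem has, pow_succ]
    simp only [Finset.prod_insert has]
    have hK : 1 ≤ ENNReal.ofReal (1 + c) := by
      rw [← ENNReal.ofReal_one]; exact ENNReal.ofReal_le_ofReal (by linarith)
    rcases s.eq_empty_or_nonempty with rfl | ⟨b, hb⟩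
    · simp only [Finset.prod_empty, mul_one, Finset.card_empty, pow_zero, one_mul, hone]
      exact le_mul_of_one_le_left (zero_le) hK
    · have hgap : ∀ i ∈ s, i + n ≤ a := fun i hi =>
        hs i (Finset.mem_insert_of_mem hi) a (Finset.mem_insert_self a s) (ha i hi)
      have hna : n ≤ a := le_trans (Nat.le_add_left n b) (hgap b hb)
      have hdep : psiDep P (sigmaOf X (Iic (a - n))) (sigmaOf X (Ici (a - n + n)))
          ≤ ENNReal.ofReal c :=
        (le_iSup (fun t => psiDep P (sigmaOf X (Iic t)) (sigmaOf X (Ici (t + n)))) (a - n)).trans hn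
      have hU : Measurable[sigmaOf X (Iic (a - n))] fun ω => ∏ i ∈ s, F (X i ω) := by
        refine Finset.measurable_fun_prod _ fun i hi => ?_
        refine hF.comp (measurable_sigmaOf X ?_)
        have := hgap i hi
        exact mem_Iic.2 (by omega)
      have hV : Measurable[sigmaOf X (Ici (a - n + n))] fun ω => F (X a ω) :=
        hF.comp (measurable_sigmaOf X (mem_Ici.2 (by omega)))
      have h := lintegral_mul_le_of_measure_inter_le (sigmaOf_le hX _) (sigmaOf_le hX _)
        (fun A D hA hD => measure_inter_le_of_psiDep_le hc hdep hA hD) hU hV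
      calc ∫⁻ ω, F (X a ω) * ∏ i ∈ s, F (X i ω) ∂P
          = ∫⁻ ω, (∏ i ∈ s, F (X i ω)) * F (X a ω) ∂P := by simp only [mul_comm]
        _ ≤ _ := h
        _ ≤ ENNReal.ofReal (1 + c) * ((ENNReal.ofReal (1 + c) * ∫⁻ x, F x ∂μ) ^ s.card
              * ∫⁻ x, F x ∂μ) := by
            rw [hone]; gcongr
        _ = _ := by ring

/-- Under `ψ`-mixing, deviations are exponentially rare at rate `N`: the indices are split into
residue classes whose modulus is so large that `(1 + ψ) E exp (t w) < exp (t (E w + η))`. -/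
theorem upperConcentration_of_psiMixing [IsProbabilityMeasure P] {X : ℕ → Ω → ℝ}
    (hX : ∀ i, Measurable (X i)) {μ : Measure ℝ} (hμ : ∀ i, P.map (X i) = μ)
    (hmix : PsiMixing P X) : UpperConcentration P X μ fun N => N := by
  intro w K hw h0 t₀ ht₀ hint η hη
  have : IsProbabilityMeasure μ := hμ 0 ▸ Measure.isProbabilityMeasure_map (hX 0).aemeasurable
  have hwm : Measurable w := hw.continuous.measurable
  obtain ⟨t, ht, -, htt, hlt⟩ := exists_mgf_lt hwm h0 ht₀ hint hη one_pos
  set a := ∫ x, w x ∂μ + η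
  have hint' := integrable_exp_mul_of_le hwm h0 htt.le hint
  have hM1 := one_le_integral_exp h0 ht.le hint'
  set M := ∫ x, Real.exp (t * w x) ∂μ with hM
  have hMpos : 0 < M := by linarith
  obtain ⟨c, hc, hcM⟩ : ∃ c, 0 < c ∧ (1 + c) * M < Real.exp (t * a) := by
    refine ⟨(Real.exp (t * a) - M) / (2 * M), div_pos (by linarith) (by linarith), ?_⟩
    have : (1 + (Real.exp (t * a) - M) / (2 * M)) * M = (Real.exp (t * a) + M) / 2 := by
      field_simp; ring
    linarith
  obtain ⟨n, hn, hn1⟩ : ∃ n, psiCoeff P X n ≤ ENNReal.ofReal c ∧ 1 ≤ n := by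
    have h1 : ∀ᶠ n in atTop, psiCoeff P X n < ENNReal.ofReal c :=
      hmix.eventually (gt_mem_nhds (ENNReal.ofReal_pos.2 hc))
    obtain ⟨n, h, h'⟩ := (h1.and (eventually_ge_atTop 1)).exists
    exact ⟨n, h.le, h'⟩
  set G := (1 + c) * M with hG
  have hG1 : 1 ≤ G := by nlinarith
  have hGpos : 0 < G := by linarith
  have hlogG : 0 ≤ Real.log G := Real.log_nonneg hG1
  have hl : 0 < t * a - Real.log G := by
    have := (Real.log_lt_iff_lt_exp hGpos).2 hcM
    linarith
  have hn' : (0 : ℝ) < n := by exact_mod_cast hn1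
  have hclass : ∀ N k, P.real {ω | N / n * a ≤ ∑ i ∈ residueClass N n k, w (X i ω)}
      ≤ G * Real.exp (-((t * a - Real.log G) / n) * N) := by
    intro N k
    set s := residueClass N n k with hs
    have hF : Measurable fun x => ENNReal.ofReal (Real.exp (t * w x)) := by fun_prop
    have h1 := lintegral_prod_le_of_psiCoeff_le hX hμ hc.le hn hF s
      fun i hi j hj hij => residueClass_gap hi hj hij
    rw [← ofReal_integral_eq_lintegral_ofReal hint' (ae_of_all _ fun x => (Real.exp_pos _).le),
      ← ENNReal.ofReal_mul (by linarith), ← ENNReal.ofReal_pow (by positivity)] at h1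
    have h2 : ∫⁻ ω, ENNReal.ofReal (Real.exp (t * ∑ i ∈ s, w (X i ω))) ∂P
        ≤ ENNReal.ofReal (G ^ s.card) := by
      refine le_trans (le_of_eq (lintegral_congr fun ω => ?_)) h1
      rw [Finset.mul_sum, Real.exp_sum, ENNReal.ofReal_prod_of_nonneg]
      exact fun i _ => (Real.exp_pos _).le
    have hmeas : Measurable fun ω => ENNReal.ofReal (Real.exp (t * ∑ i ∈ s, w (X i ω))) := by
      fun_prop
    have h3 := mul_meas_ge_le_lintegral (μ := P) hmeas
      (ENNReal.ofReal (Real.exp (t * (N / n * a))))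
    have h4 : ENNReal.ofReal (Real.exp (t * (N / n * a))) *
        P {ω | N / n * a ≤ ∑ i ∈ s, w (X i ω)} ≤ ENNReal.ofReal (G ^ s.card) := by
      refine le_trans (mul_le_mul_right (measure_mono fun ω hω => ?_) _) (h3.trans h2)
      exact ENNReal.ofReal_le_ofReal (Real.exp_le_exp.2 (mul_le_mul_of_nonneg_left hω ht.le))
    rw [← ofReal_measureReal, ← ENNReal.ofReal_mul (Real.exp_pos _).le,
      ENNReal.ofReal_le_ofReal_iff (by positivity)] at h4
    have hcard : (s.card : ℝ) ≤ N / n + 1 := by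
      refine (Nat.cast_le.2 (card_residueClass_le N n k)).trans ?_
      push_cast
      gcongr
      exact Nat.cast_div_le
    have h5 : G ^ s.card ≤ Real.exp (Real.log G * (N / n + 1)) := by
      rw [← Real.rpow_natCast, Real.rpow_def_of_pos hGpos]
      gcongr
    have h6 := h4.trans h5
    rw [mul_comm, ← le_div_iff₀ (Real.exp_pos _), ← Real.exp_sub] at h6
    refine h6.trans (le_of_eq ?_)
    nth_rewrite 2 [← Real.exp_log hGpos]
    rw [← Real.exp_add]
    congr 1
    field_simp
    ring
  refine ⟨n * G, (t * a - Real.log G) / n, by positivity, by positivity, fun N _ => ?_⟩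
  refine (measureReal_sum_ge_le P (fun i ω => w (X i ω)) N hn1 a).trans ?_
  refine (Finset.sum_le_sum fun k _ => hclass N k).trans ?_
  simp [mul_assoc]

end Mixing

/-! ### Truncated exponentials -/

section TruncatedExp

lemma abs_exp_sub_exp_le {u v : ℝ} (hu : u ≤ 0) (hv : v ≤ 0) :
    |Real.exp u - Real.exp v| ≤ |u - v| := by
  wlog h : u ≤ v generalizing u v
  · rw [abs_sub_comm, abs_sub_comm u]
    exact this hv hu (le_of_not_ge h)
  have h1 : Real.exp u = Real.exp v * Real.exp (u - v) := by rw [← Real.exp_add]; ring_nf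
  rw [abs_of_nonpos (sub_nonpos.2 (Real.exp_le_exp.2 h)), abs_of_nonpos (sub_nonpos.2 h), h1]
  nlinarith [Real.add_one_le_exp (u - v), Real.exp_pos v, Real.exp_le_one_iff.2 hv]

/-- The exponential of a sum of values of `w`, truncated at the level `c` and normalized so as
to be bounded by one: `exp (t (min (∑ w) c - c))`. -/
noncomputable def expTrunc (w : ℝ → ℝ) (t c : ℝ) (k : ℕ) (x : Fin k → ℝ) : ℝ :=
  Real.exp (t * (min (∑ a, w (x a)) c - c))

variable {w : ℝ → ℝ} {t c : ℝ}

lemma expTrunc_nonneg (k : ℕ) (x : Fin k → ℝ) : 0 ≤ expTrunc w t c k x := (Real.exp_pos _).le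

lemma expTrunc_le_one (ht : 0 ≤ t) (k : ℕ) (x : Fin k → ℝ) : expTrunc w t c k x ≤ 1 :=
  Real.exp_le_one_iff.2 (mul_nonpos_of_nonneg_of_nonpos ht (sub_nonpos.2 (min_le_right _ _)))

lemma isLipConst_expTrunc {K : NNReal} (hw : LipschitzWith K w) (ht : 0 ≤ t) (k : ℕ) :
    IsLipConst (expTrunc w t c k) (t * K) := by
  refine ⟨by positivity, fun x y => ?_⟩
  refine (abs_exp_sub_exp_le
    (mul_nonpos_of_nonneg_of_nonpos ht (sub_nonpos.2 (min_le_right _ _)))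
    (mul_nonpos_of_nonneg_of_nonpos ht (sub_nonpos.2 (min_le_right _ _)))).trans ?_
  rw [← mul_sub, abs_mul, abs_of_nonneg ht, mul_assoc]
  refine mul_le_mul_of_nonneg_left ?_ ht
  rw [sub_sub_sub_cancel_right]
  refine (abs_min_sub_min_le_max _ _ _ _).trans ?_
  rw [sub_self, abs_zero, max_eq_left (abs_nonneg _), ← Finset.sum_sub_distrib, Finset.mul_sum]
  refine (Finset.abs_sum_le_sum_abs _ _).trans (Finset.sum_le_sum fun a _ => ?_)
  simpa [Real.dist_eq] using hw.dist_le_mul (x a) (y a)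

lemma expTrunc_mem_boundedLip {K : NNReal} (hw : LipschitzWith K w) (ht : 0 ≤ t) (k : ℕ) :
    expTrunc w t c k ∈ boundedLip k :=
  ⟨fun x => by
    rw [abs_of_nonneg (expTrunc_nonneg k x)]
    exact expTrunc_le_one ht k x, _, isLipConst_expTrunc hw ht k⟩

lemma lipMod_nonneg {k : ℕ} (f : (Fin k → ℝ) → ℝ) : 0 ≤ lipMod f :=
  Real.sInf_nonneg fun _ hL => hL.1

lemma lipMod_expTrunc_le {K : NNReal} (hw : LipschitzWith K w) (ht : 0 ≤ t) (k : ℕ) :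
    lipMod (expTrunc w t c k) ≤ t * K :=
  csInf_le ⟨0, fun _ hL => hL.1⟩ (isLipConst_expTrunc hw ht k)

end TruncatedExp

/-! ### Concentration under weak dependence -/

section Weak

variable {Ω : Type*} [MeasurableSpace Ω] {P : Measure Ω}

/-- Covariance bound for the truncated exponentials of two groups of variables separated by a
gap, the second group being a single variable. -/
lemma integral_expTrunc_mul_le [IsProbabilityMeasure P] {X : ℕ → Ω → ℝ}
    (hX : ∀ i, Measurable (X i)) {β A : ℝ} {p : ℕ}
    {ψ : (n m : ℕ) → ((Fin n → ℝ) → ℝ) → ((Fin m → ℝ) → ℝ) → ℝ}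
    (hψ : ∀ n m : ℕ, ∀ f ∈ boundedLip n, ∀ h ∈ boundedLip m,
      ψ n m f h ≤ A * ((1 + n) * (1 + m) * (1 + lipMod f) * (1 + lipMod h)) ^ p)
    (hdep : WeakDependent P X (fun r => Real.exp (-β * r)) boundedLip ψ)
    {w : ℝ → ℝ} {K : NNReal} (hw : LipschitzWith K w) {t c : ℝ} (ht : 0 ≤ t)
    {s : Finset ℕ} (hs : s.Nonempty) {a n : ℕ} (hn : 1 ≤ n) (hgap : ∀ i ∈ s, i + n ≤ a) :
    ∫ ω, Real.exp (t * (min (∑ i ∈ s, w (X i ω)) c - c))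
        * Real.exp (t * (min (w (X a ω)) c - c)) ∂P
      ≤ (∫ ω, Real.exp (t * (min (∑ i ∈ s, w (X i ω)) c - c)) ∂P)
          * (∫ ω, Real.exp (t * (min (w (X a ω)) c - c)) ∂P)
        + |A| * ((1 + s.card) * 2 * (1 + t * K) ^ 2) ^ p * Real.exp (-β * (n - 1 : ℕ)) := by
  have hwm : Measurable w := hw.continuous.measurable
  set e := s.orderEmbOfFin rfl
  have hsum : ∀ ω, ∑ b, w (X (e b) ω) = ∑ i ∈ s, w (X i ω) := by
    intro ω
    conv_rhs => rw [← Finset.map_orderEmbOfFin_univ s rfl, Finset.sum_map]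
    rfl
  have hcov := hdep s.card 1 (n - 1) hs.card_pos le_rfl e (fun _ => a) e.monotone
    monotone_const
    (fun b _ => by have := hgap (e b) (Finset.orderEmbOfFin_mem s rfl b); omega)
    _ (expTrunc_mem_boundedLip (c := c) hw ht _) _ (expTrunc_mem_boundedLip (c := c) hw ht _)
  have hU : Measurable fun ω => expTrunc w t c s.card fun b => X (e b) ω := by
    unfold expTrunc; fun_prop
  have hV : Measurable fun ω => expTrunc w t c 1 fun _ => X a ω := by
    unfold expTrunc; fun_prop
  have hmem : ∀ {k : ℕ} {f : Ω → Fin k → ℝ}, Measurable (fun ω => expTrunc w t c k (f ω)) →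
      MemLp (fun ω => expTrunc w t c k (f ω)) 2 P := by
    intro k f hf
    refine MemLp.of_bound hf.aestronglyMeasurable 1 (ae_of_all _ fun ω => ?_)
    rw [Real.norm_of_nonneg (expTrunc_nonneg _ _)]
    exact expTrunc_le_one ht _ _
  rw [covariance_eq_sub (hmem hU) (hmem hV)] at hcov
  have h1 := (le_abs_self _).trans hcov
  have h2 : ψ s.card 1 (expTrunc w t c s.card) (expTrunc w t c 1)
      ≤ |A| * ((1 + s.card) * 2 * (1 + t * K) ^ 2) ^ p := by
    refine (hψ _ _ _ (expTrunc_mem_boundedLip hw ht _) _ (expTrunc_mem_boundedLip hw ht _)).trans ?_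
    have hl1 := lipMod_nonneg (expTrunc w t c s.card)
    have hl2 := lipMod_nonneg (expTrunc w t c 1)
    have hu1 := lipMod_expTrunc_le (c := c) hw ht s.card
    have hu2 := lipMod_expTrunc_le (c := c) hw ht 1
    have hbase : ((1 + s.card) * (1 + (1 : ℕ)) * (1 + lipMod (expTrunc w t c s.card))
        * (1 + lipMod (expTrunc w t c 1)) : ℝ) ≤ (1 + s.card) * 2 * (1 + t * K) ^ 2 := by
      rw [pow_two, ← mul_assoc, Nat.cast_one, one_add_one_eq_two]
      gcongr
    have hbase0 : (0 : ℝ) ≤ (1 + s.card) * (1 + (1 : ℕ))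
        * (1 + lipMod (expTrunc w t c s.card)) * (1 + lipMod (expTrunc w t c 1)) := by
      positivity
    refine (mul_le_mul_of_nonneg_right (le_abs_self A) (by positivity)).trans ?_
    gcongr
  have h3 := mul_le_mul_of_nonneg_right h2 (Real.exp_pos (-β * (n - 1 : ℕ))).le
  simp only [expTrunc, Pi.mul_apply, hsum, Finset.univ_unique, Finset.sum_singleton] at h1 h3 ⊢
  linarith

/-- Under weak dependence, the probability that a sum over indices `n` apart exceeds the level
`c` is, up to an error, bounded as for independent variables. The exponential of the sum is
truncated at the level `c`; as `w ≥ 0`, the truncated exponentials remain submultiplicative, and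
the errors are multiplied by `exp (t c)` only, although `w` may be unbounded. -/
lemma measureReal_sum_ge_le_of_weak [IsProbabilityMeasure P] {X : ℕ → Ω → ℝ}
    (hX : ∀ i, Measurable (X i)) {μ : Measure ℝ} (hμ : ∀ i, P.map (X i) = μ) {β A : ℝ} {p : ℕ}
    {ψ : (n m : ℕ) → ((Fin n → ℝ) → ℝ) → ((Fin m → ℝ) → ℝ) → ℝ}
    (hψ : ∀ n m : ℕ, ∀ f ∈ boundedLip n, ∀ h ∈ boundedLip m,
      ψ n m f h ≤ A * ((1 + n) * (1 + m) * (1 + lipMod f) * (1 + lipMod h)) ^ p)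
    (hdep : WeakDependent P X (fun r => Real.exp (-β * r)) boundedLip ψ)
    {w : ℝ → ℝ} {K : NNReal} (hw : LipschitzWith K w) (h0 : ∀ x, 0 ≤ w x) {t c : ℝ}
    (ht : 0 ≤ t) (hc : 0 ≤ c) (hint : Integrable (fun x => Real.exp (t * w x)) μ) {n : ℕ}
    (hn : 1 ≤ n) {m : ℕ} {s : Finset ℕ} (hsm : s.card ≤ m)
    (hs : ∀ i ∈ s, ∀ j ∈ s, i < j → i + n ≤ j) :
    P.real {ω | c ≤ ∑ i ∈ s, w (X i ω)}
      ≤ (∫ x, Real.exp (t * w x) ∂μ) ^ s.card * (Real.exp (-(t * c)) + s.card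
          * (Real.exp (t * c) * (|A| * ((1 + m) * 2 * (1 + t * K) ^ 2) ^ p
            * Real.exp (-β * (n - 1 : ℕ))))) := by
  have : IsProbabilityMeasure μ := hμ 0 ▸ Measure.isProbabilityMeasure_map (hX 0).aemeasurable
  have hwm : Measurable w := hw.continuous.measurable
  have hM1 := one_le_integral_exp h0 ht hint
  set M := ∫ x, Real.exp (t * w x) ∂μ with hM
  set R := |A| * ((1 + m) * 2 * (1 + t * K) ^ 2) ^ p * Real.exp (-β * (n - 1 : ℕ)) with hR
  have hR0 : 0 ≤ R := by positivity
  have hbd : ∀ y : ℝ, Real.exp (t * (min y c - c)) ≤ 1 := fun y =>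
    Real.exp_le_one_iff.2 (mul_nonpos_of_nonneg_of_nonpos ht (sub_nonpos.2 (min_le_right _ _)))
  have hintU : ∀ Y : Ω → ℝ, Measurable Y →
      Integrable (fun ω => Real.exp (t * (min (Y ω) c - c))) P := by
    intro Y hY
    refine Integrable.of_bound (by fun_prop) 1 (ae_of_all _ fun ω => ?_)
    rw [Real.norm_of_nonneg (Real.exp_pos _).le]
    exact hbd _
  have hmoment : ∀ s : Finset ℕ, s.card ≤ m → (∀ i ∈ s, ∀ j ∈ s, i < j → i + n ≤ j) →
      ∫ ω, Real.exp (t * (min (∑ i ∈ s, w (X i ω)) c - c)) ∂P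
        ≤ M ^ s.card * (Real.exp (-(t * c)) + s.card * (Real.exp (t * c) * R)) := by
    intro s
    induction s using Finset.induction_on_max with
    | empty => intro _ _; simp [hc]
    | insert a s ha ih =>
      intro hcard hsep
      have has : a ∉ s := fun h => lt_irrefl _ (ha a h)
      rw [Finset.card_insert_of_notMem has] at hcard ⊢
      have ih' := ih (by omega) fun i hi j hj => hsep i (Finset.mem_insert_of_mem hi) j
        (Finset.mem_insert_of_mem hj)
      have hgap : ∀ i ∈ s, i + n ≤ a := fun i hi =>
        hsep i (Finset.mem_insert_of_mem hi) a (Finset.mem_insert_self a s) (ha i hi)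
      have hone : Real.exp (t * c) * ∫ ω, Real.exp (t * (min (w (X a ω)) c - c)) ∂P ≤ M := by
        rw [← integral_const_mul, hM, ← hμ a,
          integral_map (hX a).aemeasurable (by fun_prop)]
        refine integral_mono ((hintU _ (by fun_prop)).const_mul _) ?_ fun ω => ?_
        · rw [← hμ a] at hint
          exact hint.comp_measurable (hX a)
        · simp only
          rw [← Real.exp_add]
          refine Real.exp_le_exp.2 ?_
          have := mul_le_mul_of_nonneg_left (min_le_left (w (X a ω)) c) ht
          linarith
      have hprod : ∫ ω, Real.exp (t * (min (∑ i ∈ s, w (X i ω)) c - c))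
          * Real.exp (t * (min (w (X a ω)) c - c)) ∂P
          ≤ (∫ ω, Real.exp (t * (min (∑ i ∈ s, w (X i ω)) c - c)) ∂P)
            * (∫ ω, Real.exp (t * (min (w (X a ω)) c - c)) ∂P) + R := by
        rcases s.eq_empty_or_nonempty with rfl | hne
        · simp only [Finset.sum_empty, integral_const_mul, integral_const, probReal_univ, one_smul]
          linarith
        · refine (integral_expTrunc_mul_le hX hψ hdep hw ht hne hn hgap).trans ?_
          have : (s.card : ℝ) ≤ m := by exact_mod_cast (by omega)
          rw [hR]
          gcongr
      have hstep : ∫ ω, Real.exp (t * (min (∑ i ∈ insert a s, w (X i ω)) c - c)) ∂P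
          ≤ Real.exp (t * c) * ∫ ω, Real.exp (t * (min (∑ i ∈ s, w (X i ω)) c - c))
            * Real.exp (t * (min (w (X a ω)) c - c)) ∂P := by
        rw [← integral_const_mul]
        refine integral_mono (hintU _ (by fun_prop)) (Integrable.const_mul ?_ _) fun ω => ?_
        · refine (hintU (fun ω => w (X a ω)) (by fun_prop)).bdd_mul (c := 1)
            (Measurable.aestronglyMeasurable (by fun_prop)) (ae_of_all _ fun ω => ?_)
          rw [Real.norm_of_nonneg (Real.exp_pos _).le]
          exact hbd _
        · simp only [Finset.sum_insert has]
          rw [← Real.exp_add, ← Real.exp_add]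
          refine Real.exp_le_exp.2 ?_
          have hS : 0 ≤ ∑ i ∈ s, w (X i ω) := Finset.sum_nonneg fun i _ => h0 _
          have hmin : min (w (X a ω) + ∑ i ∈ s, w (X i ω)) c
              ≤ min (∑ i ∈ s, w (X i ω)) c + min (w (X a ω)) c := by
            have hz := h0 (X a ω)
            rcases le_total (∑ i ∈ s, w (X i ω)) c with h | h <;>
            rcases le_total (w (X a ω)) c with h' | h' <;>
            simp only [h, h', min_eq_left, min_eq_right]
            · exact (min_le_left _ _).trans (by linarith)
            · exact (min_le_right _ _).trans (by linarith)
            · exact (min_le_right _ _).trans (by linarith)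
            · exact (min_le_right _ _).trans (by linarith)
          have := mul_le_mul_of_nonneg_left hmin ht
          linarith
      set u := ∫ ω, Real.exp (t * (min (∑ i ∈ s, w (X i ω)) c - c)) ∂P with hu
      have hu0 : 0 ≤ u := integral_nonneg fun ω => (Real.exp_pos _).le
      set v := ∫ ω, Real.exp (t * (min (w (X a ω)) c - c)) ∂P
      calc _ ≤ _ := hstep
        _ ≤ Real.exp (t * c) * (u * v + R) := by gcongr
        _ = (Real.exp (t * c) * v) * u + Real.exp (t * c) * R := by ring
        _ ≤ M * (M ^ s.card * (Real.exp (-(t * c)) + s.card * (Real.exp (t * c) * R)))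
            + M ^ (s.card + 1) * (Real.exp (t * c) * R) := by
          refine add_le_add (mul_le_mul hone ih' hu0 (by linarith)) ?_
          exact le_mul_of_one_le_left (by positivity) (one_le_pow₀ hM1)
        _ = _ := by push_cast; ring
  refine le_trans ?_ (hmoment s hsm hs)
  have hmarkov := mul_meas_ge_le_integral_of_nonneg
    (ae_of_all P fun ω => (Real.exp_pos (t * (min (∑ i ∈ s, w (X i ω)) c - c))).le)
    (hintU _ (by fun_prop)) 1
  rw [one_mul] at hmarkov
  refine le_trans (measureReal_mono (fun ω hω => ?_)) hmarkov
  have hω' : c ≤ ∑ i ∈ s, w (X i ω) := hω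
  simp [hω']

lemma exists_pow_le_mul_exp {b : ℝ} (hb : 0 < b) (k : ℕ) :
    ∃ C : ℝ, 0 < C ∧ ∀ x : ℝ, 0 ≤ x → x ^ k ≤ C * Real.exp (b * x) := by
  refine ⟨k.factorial / b ^ k, by positivity, fun x hx => ?_⟩
  have h := Real.pow_div_factorial_le_exp (b * x) (by positivity) k
  rw [div_le_iff₀ (by positivity), mul_pow] at h
  rw [div_mul_eq_mul_div, le_div_iff₀ (by positivity)]
  linarith

/-- Under weak dependence, deviations are exponentially rare at rate `√N`: the indices below `N`
are split into about `√N` residue classes of about `√N` elements each, so that both the number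
of factors and the gaps between them are of order `√N`. -/
theorem upperConcentration_of_psiWeakDependent [IsProbabilityMeasure P] {X : ℕ → Ω → ℝ}
    (hX : ∀ i, Measurable (X i)) {μ : Measure ℝ} (hμ : ∀ i, P.map (X i) = μ)
    (hweak : PsiWeakDependent P X) : UpperConcentration P X μ fun N => √(N : ℝ) := by
  intro w K hw h0 t₀ ht₀ hint η hη
  obtain ⟨β, ψ, hβ, ⟨A, p, hψ⟩, hdep⟩ := hweak
  have : IsProbabilityMeasure μ := hμ 0 ▸ Measure.isProbabilityMeasure_map (hX 0).aemeasurable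
  have hwm : Measurable w := hw.continuous.measurable
  have ha0 : 0 < ∫ x, w x ∂μ + η := add_pos_of_nonneg_of_pos (integral_nonneg h0) hη
  -- with this `t`, the factor `exp (t a (2 q + 1))`, `q ≤ 4 n`, is absorbed by `exp (-β n)`
  obtain ⟨t, ht, htβ, htt, hlt⟩ := exists_mgf_lt hwm h0 ht₀ hint hη
    (τ := β / (18 * (∫ x, w x ∂μ + η))) (by positivity)
  set a := ∫ x, w x ∂μ + η
  have htβ' : 9 * (t * a) ≤ β / 2 := by
    have := (lt_div_iff₀ (by positivity)).1 htβ
    linarith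
  have hint' := integrable_exp_mul_of_le hwm h0 htt.le hint
  have hM1 := one_le_integral_exp h0 ht.le hint'
  have hprob := fun (n : ℕ) (hn : 1 ≤ n) (c : ℝ) (hc : 0 ≤ c) (m : ℕ) (s : Finset ℕ)
    (hsm : s.card ≤ m) => measureReal_sum_ge_le_of_weak hX hμ hψ hdep hw h0 ht.le hc hint' hn hsm
  set M := ∫ x, Real.exp (t * w x) ∂μ with hM
  have hMpos : 0 < M := by linarith
  have hl : 0 < t * a - Real.log M := by
    have := (Real.log_lt_iff_lt_exp hMpos).2 hlt
    linarith
  set l := t * a - Real.log M with hl_def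
  set d := min l (β / 2) with hd_def
  have hd : 0 < d := lt_min hl (by positivity)
  obtain ⟨C, hC, hCx⟩ := exists_pow_le_mul_exp (b := d / 8) (by positivity) (p + 2)
  set Q := M + |A| * (2 * (1 + t * K) ^ 2) ^ p * Real.exp β with hQ
  have hQpos : 0 < Q := by positivity
  refine ⟨Q * C * Real.exp (d / 4 + d / 2), d / 2, by positivity, by positivity, fun N hN => ?_⟩
  set n := Nat.sqrt N with hn_def
  have hn1 : 1 ≤ n := Nat.sqrt_pos.2 hN
  have hn1' : (1 : ℝ) ≤ n := by exact_mod_cast hn1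
  have hnle : (n : ℝ) * n ≤ N := by exact_mod_cast Nat.sqrt_le N
  have hnlt : (N : ℝ) < (n + 1) * (n + 1) := by exact_mod_cast Nat.lt_succ_sqrt N
  have hq1 : (n : ℝ) ≤ N / n := by rw [le_div_iff₀ (by linarith)]; exact hnle
  have hq2 : (N : ℝ) / n ≤ 4 * n := by rw [div_le_iff₀ (by linarith)]; nlinarith
  have hsqrt : √(N : ℝ) ≤ n + 1 := by
    rw [Real.sqrt_le_left (by linarith)]; nlinarith
  set q : ℝ := (N : ℝ) / n with hq_def
  set x : ℝ := 4 * n + 2 with hx_def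
  have hx1 : 1 ≤ x := by linarith
  have hclass : ∀ k, P.real {ω | q * a ≤ ∑ i ∈ residueClass N n k, w (X i ω)}
      ≤ Q * x ^ (p + 1) * Real.exp (-d * n) := by
    intro k
    set s := residueClass N n k with hs
    have hcard := card_residueClass_le N n k
    have hcard' : ((N / n + 1 : ℕ) : ℝ) ≤ q + 1 := by
      push_cast
      gcongr
      exact Nat.cast_div_le
    have hcs : (s.card : ℝ) ≤ q + 1 := (Nat.cast_le.2 hcard).trans hcard'
    refine (hprob n hn1 (q * a) (by positivity) _ s hcard
      fun i hi j hj hij => residueClass_gap hi hj hij).trans ?_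
    have hMs : M ^ s.card ≤ Real.exp (Real.log M * (q + 1)) := by
      rw [← Real.rpow_natCast, Real.rpow_def_of_pos hMpos]
      have := Real.log_nonneg hM1
      gcongr
    have hlogM : Real.log M ≤ t * a := by linarith
    have hta : 0 < t * a := by positivity
    have h1 : M ^ s.card * Real.exp (-(t * (q * a))) ≤ M * Real.exp (-d * n) := by
      refine (mul_le_mul_of_nonneg_right hMs (Real.exp_pos _).le).trans ?_
      nth_rewrite 2 [← Real.exp_log hMpos]
      rw [← Real.exp_add, ← Real.exp_add]
      refine Real.exp_le_exp.2 ?_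
      have h3 : d * n ≤ l * q := mul_le_mul (min_le_left _ _) hq1 (by positivity) hl.le
      rw [hl_def] at h3
      linarith
    have h2 : M ^ s.card * (Real.exp (t * (q * a)) * Real.exp (-β * (n - 1 : ℕ)))
        ≤ Real.exp β * Real.exp (-d * n) := by
      refine (mul_le_mul_of_nonneg_right hMs (by positivity)).trans ?_
      rw [← Real.exp_add, ← Real.exp_add, ← Real.exp_add]
      refine Real.exp_le_exp.2 ?_
      rw [Nat.cast_sub hn1, Nat.cast_one]
      have h3 : Real.log M * (q + 1) ≤ t * a * (q + 1) := by gcongr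
      have h4 : t * a * (2 * q + 1) ≤ t * a * (9 * n) := by gcongr; linarith
      have h5 : 9 * (t * a) * n ≤ β / 2 * n := by gcongr
      have h6 : d * n ≤ β / 2 * n := by gcongr; exact min_le_right _ _
      linarith
    have hm : (1 + ((N / n + 1 : ℕ) : ℝ)) ≤ x := by linarith
    have hpoly : ((1 + ((N / n + 1 : ℕ) : ℝ)) * 2 * (1 + t * K) ^ 2) ^ p
        ≤ x ^ p * (2 * (1 + t * K) ^ 2) ^ p := by
      rw [← mul_pow, ← mul_assoc]
      gcongr
    have hcx : (s.card : ℝ) ≤ x := by linarith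
    have hxp : 1 ≤ x ^ (p + 1) := one_le_pow₀ hx1
    calc _ = M ^ s.card * Real.exp (-(t * (q * a)))
          + s.card * (|A| * ((1 + ((N / n + 1 : ℕ) : ℝ)) * 2 * (1 + t * K) ^ 2) ^ p)
            * (M ^ s.card * (Real.exp (t * (q * a)) * Real.exp (-β * (n - 1 : ℕ)))) := by ring
      _ ≤ x ^ (p + 1) * (M * Real.exp (-d * n))
          + x * (|A| * (x ^ p * (2 * (1 + t * K) ^ 2) ^ p))
            * (Real.exp β * Real.exp (-d * n)) := by
        refine add_le_add (h1.trans (le_mul_of_one_le_left (by positivity) hxp)) ?_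
        gcongr
      _ = _ := by rw [hQ]; ring
  refine (measureReal_sum_ge_le P (fun i ω => w (X i ω)) N hn1 a).trans ?_
  refine (Finset.sum_le_sum fun k _ => hclass k).trans ?_
  rw [Finset.sum_const, Finset.card_range, nsmul_eq_mul]
  calc (n : ℝ) * (Q * x ^ (p + 1) * Real.exp (-d * n))
      ≤ x * (Q * x ^ (p + 1) * Real.exp (-d * n)) := by gcongr; linarith
    _ = Q * x ^ (p + 2) * Real.exp (-d * n) := by ring
    _ ≤ Q * (C * Real.exp (d / 8 * x)) * Real.exp (-d * n) := by
      gcongr; exact hCx x (by linarith)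
    _ = Q * C * Real.exp (d / 4 - d / 2 * n) := by
      rw [← mul_assoc, mul_assoc, ← Real.exp_add, hx_def]; ring_nf
    _ ≤ Q * C * Real.exp (d / 4 + d / 2 + -(d / 2) * √N) := by
      gcongr
      nlinarith
    _ = _ := by rw [Real.exp_add]; ring

end Weak

/-! ### Concentration for Lipschitz functions of any sign -/

section Means

variable {Ω : Type*} [MeasurableSpace Ω] {P : Measure Ω} [IsProbabilityMeasure P]
  {X : ℕ → Ω → ℝ} {μ : Measure ℝ} [IsProbabilityMeasure μ] {r : ℕ → ℝ}

omit [IsProbabilityMeasure μ] in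
lemma integrable_of_integrable_exp {u : ℝ → ℝ} (hu : Measurable u) {t₀ : ℝ} (ht₀ : 0 < t₀)
    (hint : Integrable (fun x => Real.exp (t₀ * |u x|)) μ) : Integrable u μ := by
  refine (hint.const_mul (1 / t₀)).mono' hu.aestronglyMeasurable (ae_of_all _ fun x => ?_)
  rw [Real.norm_eq_abs, one_div, ← div_eq_inv_mul, le_div_iff₀ ht₀]
  linarith [Real.add_one_le_exp (t₀ * |u x|)]

omit [IsProbabilityMeasure μ] in
lemma exists_integral_max_neg_le {u : ℝ → ℝ} (hu : Integrable u μ) {η : ℝ} (hη : 0 < η) :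
    ∃ R : ℝ, 0 ≤ R ∧ ∫ x, max (u x) (-R) ∂μ ≤ ∫ x, u x ∂μ + η := by
  have hlim : Tendsto (fun n : ℕ => ∫ x, max (u x) (-(n : ℝ)) ∂μ) atTop (𝓝 (∫ x, u x ∂μ)) := by
    refine tendsto_integral_of_dominated_convergence (fun x => |u x|)
      (fun n => hu.aestronglyMeasurable.sup aestronglyMeasurable_const) hu.abs
      (fun n => ae_of_all _ fun x => ?_) (ae_of_all _ fun x => ?_)
    · have hn : (0 : ℝ) ≤ n := n.cast_nonneg
      refine abs_le.2 ⟨(neg_abs_le _).trans (le_max_left _ _), max_le (le_abs_self _) ?_⟩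
      linarith [abs_nonneg (u x)]
    · refine tendsto_const_nhds.congr' ?_
      filter_upwards [eventually_ge_atTop ⌈|u x|⌉₊] with n hn
      have h := Nat.ceil_le.1 hn
      exact (max_eq_left (by linarith [neg_abs_le (u x)])).symm
  obtain ⟨n, hn⟩ := (hlim.eventually (gt_mem_nhds (lt_add_of_pos_right _ hη))).exists
  exact ⟨n, n.cast_nonneg, hn.le⟩

/-- The concentration property extends to Lipschitz functions of any sign with an exponential
moment, by clipping them from below. -/
lemma UpperConcentration.expRare_le_sum (hconc : UpperConcentration P X μ r) {u : ℝ → ℝ}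
    {K : NNReal} (hu : LipschitzWith K u) {t₀ : ℝ} (ht₀ : 0 < t₀)
    (hint : Integrable (fun x => Real.exp (t₀ * |u x|)) μ) {η : ℝ} (hη : 0 < η) :
    ExpRare P r fun N =>
      {ω | N * (∫ x, u x ∂μ + η) ≤ ∑ i ∈ Finset.range N, u (X i ω)} := by
  have hum : Measurable u := hu.continuous.measurable
  have hui := integrable_of_integrable_exp hum ht₀ hint
  obtain ⟨R, hR, hle⟩ := exists_integral_max_neg_le hui (half_pos hη)
  have hlip : LipschitzWith K fun x => max (u x) (-R) + R :=
    LipschitzWith.of_dist_le_mul fun x y => by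
      rw [dist_add_right]
      exact (hu.max_const (-R)).dist_le_mul x y
  have h0 : ∀ x, 0 ≤ max (u x) (-R) + R := fun x => by linarith [le_max_right (u x) (-R)]
  have hexp : Integrable (fun x => Real.exp (t₀ * (max (u x) (-R) + R))) μ := by
    refine (hint.mul_const (Real.exp (t₀ * R))).mono' (by fun_prop) (ae_of_all _ fun x => ?_)
    rw [Real.norm_of_nonneg (Real.exp_pos _).le, ← Real.exp_add, ← mul_add]
    refine Real.exp_le_exp.2 (mul_le_mul_of_nonneg_left ?_ ht₀.le)
    gcongr
    exact max_le (le_abs_self _) (by linarith [abs_nonneg (u x)])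
  refine (hconc _ K hlip h0 t₀ ht₀ hexp (η / 2) (half_pos hη)).mono fun N _ ω hω => ?_
  have hω' : (N : ℝ) * (∫ x, u x ∂μ + η) ≤ ∑ i ∈ Finset.range N, u (X i ω) := hω
  change (N : ℝ) * _ ≤ _
  have hint_max : Integrable (fun x => max (u x) (-R)) μ := hui.sup (integrable_const _)
  have hI : ∫ x, (max (u x) (-R) + R) ∂μ = ∫ x, max (u x) (-R) ∂μ + R := by
    rw [integral_add hint_max (integrable_const _)]; simp
  have hsum : ∑ i ∈ Finset.range N, u (X i ω) + N * R
      ≤ ∑ i ∈ Finset.range N, (max (u (X i ω)) (-R) + R) := by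
    rw [Finset.sum_add_distrib, Finset.sum_const, Finset.card_range, nsmul_eq_mul]
    gcongr
    exact le_max_left _ _
  have hN : (0 : ℝ) ≤ N := N.cast_nonneg
  have : (N : ℝ) * (∫ x, (max (u x) (-R) + R) ∂μ + η / 2)
      ≤ N * (∫ x, u x ∂μ + η + R) := by
    rw [hI]
    exact mul_le_mul_of_nonneg_left (by linarith) hN
  linarith

lemma UpperConcentration.expRare_abs_sub (hconc : UpperConcentration P X μ r)
    (hr : ∀ N, 0 ≤ r N) {u : ℝ → ℝ} {K : NNReal} (hu : LipschitzWith K u) {t₀ : ℝ}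
    (ht₀ : 0 < t₀) (hint : Integrable (fun x => Real.exp (t₀ * |u x|)) μ) {η : ℝ}
    (hη : 0 < η) :
    ExpRare P r fun N =>
      {ω | η ≤ |1 / (N : ℝ) * ∑ i ∈ Finset.range N, u (X i ω) - ∫ x, u x ∂μ|} := by
  have h1 := hconc.expRare_le_sum hu ht₀ hint hη
  have h2 := hconc.expRare_le_sum (u := fun x => -u x) hu.neg ht₀
    (by simpa only [abs_neg] using hint) hη
  refine (h1.union hr h2).mono fun N hN ω hω => ?_
  have hN' : (0 : ℝ) < N := by exact_mod_cast hN
  have hmul : (N : ℝ) * (1 / (N : ℝ) * ∑ i ∈ Finset.range N, u (X i ω))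
      = ∑ i ∈ Finset.range N, u (X i ω) := by field_simp
  have hω' : η ≤ |1 / (N : ℝ) * ∑ i ∈ Finset.range N, u (X i ω) - ∫ x, u x ∂μ| := hω
  rcases le_abs.1 hω' with h | h
  · left
    change (N : ℝ) * (∫ x, u x ∂μ + η) ≤ _
    rw [← hmul]
    gcongr
    linarith
  · right
    change (N : ℝ) * (∫ x, -u x ∂μ + η) ≤ ∑ i ∈ Finset.range N, -u (X i ω)
    rw [Finset.sum_neg_distrib, ← hmul, ← mul_neg, integral_neg]
    gcongr
    linarith

lemma UpperConcentration.expRare_abs_sub_of_bounded (hconc : UpperConcentration P X μ r)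
    (hr : ∀ N, 0 ≤ r N) {u : ℝ → ℝ} {K : NNReal} (hu : LipschitzWith K u) {c : ℝ}
    (hc : ∀ x, |u x| ≤ c) {η : ℝ} (hη : 0 < η) :
    ExpRare P r fun N =>
      {ω | η ≤ |1 / (N : ℝ) * ∑ i ∈ Finset.range N, u (X i ω) - ∫ x, u x ∂μ|} := by
  have hum : Measurable u := hu.continuous.measurable
  refine hconc.expRare_abs_sub hr hu one_pos ?_ hη
  refine Integrable.of_bound (by fun_prop) (Real.exp (1 * c)) (ae_of_all _ fun x => ?_)
  rw [Real.norm_of_nonneg (Real.exp_pos _).le]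
  have := hc x
  gcongr

end Means

/-! ### The statistic as a mean over a window -/

section Window

/-- The function `u ↦ u` on `|u| < b`, extended by zero. -/
noncomputable def window (b u : ℝ) : ℝ := if |u| < b then u else 0

lemma abs_window_le (b u : ℝ) : |window b u| ≤ |u| := by
  unfold window; split_ifs <;> simp

lemma abs_window_le_max (b u : ℝ) : |window b u| ≤ max b 0 := by
  unfold window
  split_ifs with h
  · exact h.le.trans (le_max_left _ _)
  · simp

lemma measurable_window (b : ℝ) : Measurable (window b) :=
  Measurable.ite (measurableSet_lt measurable_norm measurable_const) measurable_id
    measurable_const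

/-- As `N₁ + N₂ = N` and the two sums add up to `N θ_N`, the statistic is the empirical mean of
the centred observations, restricted to the window. -/
lemma PsiN_eq (x : ℕ → ℝ) {N : ℕ} (hN : 1 ≤ N) (b : ℝ) :
    PsiN x N b = 1 / (N : ℝ) * ∑ i ∈ Finset.range N, window b (x i - sampleMean x N) := by
  classical
  have hN' : (N : ℝ) ≠ 0 := by positivity
  have hab : abnormal x N b
      = (Finset.range N).filter fun i => ¬ |x i - sampleMean x N| < b := by
    simp only [abnormal, not_lt]
  have hord : ordinary x N b = (Finset.range N).filter fun i => |x i - sampleMean x N| < b := by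
    simp only [ordinary]
  have hsum : ∑ i ∈ ordinary x N b, x i + ∑ i ∈ abnormal x N b, x i = N * sampleMean x N := by
    rw [hab, hord, Finset.sum_filter_add_sum_filter_not, sampleMean]
    field_simp
  have hcard : ((ordinary x N b).card : ℝ) + (abnormal x N b).card = N := by
    rw [hab, hord]
    exact_mod_cast (by
      rw [Finset.card_filter_add_card_filter_not, Finset.card_range])
  have hwin : ∑ i ∈ Finset.range N, window b (x i - sampleMean x N)
      = ∑ i ∈ ordinary x N b, x i - (ordinary x N b).card * sampleMean x N := by
    simp only [window]
    rw [← Finset.sum_filter, ← hord, Finset.sum_sub_distrib, Finset.sum_const, nsmul_eq_mul]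
  rw [PsiN, hwin]
  have h1 : ∑ i ∈ abnormal x N b, x i = N * sampleMean x N - ∑ i ∈ ordinary x N b, x i := by
    linarith
  have h2 : ((abnormal x N b).card : ℝ) = N - (ordinary x N b).card := by linarith
  rw [h1, h2]
  field_simp
  ring

lemma abs_PsiN_le (x : ℕ → ℝ) {N : ℕ} (hN : 1 ≤ N) {b B : ℝ} (hb : b ≤ B) (hB : 0 ≤ B) :
    |PsiN x N b| ≤ B := by
  have hN' : (0 : ℝ) < N := by exact_mod_cast hN
  rw [PsiN_eq x hN, one_div, ← div_eq_inv_mul, abs_div, abs_of_pos hN', div_le_iff₀ hN']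
  refine (Finset.abs_sum_le_sum_abs _ _).trans ?_
  refine (Finset.sum_le_sum fun i _ => (abs_window_le_max b _).trans (max_le hb hB)).trans ?_
  simp [mul_comm]

/-- A Lipschitz bump that is at least `1 / 2` within distance `2 η` of the two points `±b`. -/
noncomputable def edgeBump (b η u : ℝ) : ℝ := max 0 (1 - |(|u| - b)| / (4 * η))

/-- A Lipschitz approximation of `window b`, which differs from it near the points `±b` only. -/
noncomputable def lipWindow (b η u : ℝ) : ℝ :=
  max (-(b / (2 * η) * max 0 (b - |u|))) (min u (b / (2 * η) * max 0 (b - |u|)))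

variable {b η : ℝ}

lemma edgeBump_nonneg (b η u : ℝ) : 0 ≤ edgeBump b η u := le_max_left _ _

lemma edgeBump_le_one (hη : 0 < η) (u : ℝ) : edgeBump b η u ≤ 1 := by
  have : 0 ≤ |(|u| - b)| / (4 * η) := by positivity
  exact max_le zero_le_one (by linarith)

lemma half_le_edgeBump (hη : 0 < η) {u : ℝ} (hu : |(|u| - b)| ≤ 2 * η) :
    1 / 2 ≤ edgeBump b η u := by
  have : |(|u| - b)| / (4 * η) ≤ 1 / 2 := by rw [div_le_iff₀ (by positivity)]; linarith
  exact le_trans (by linarith) (le_max_right _ _)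

lemma lipschitzWith_abs_abs_sub (b : ℝ) : LipschitzWith 1 fun u : ℝ => |(|u| - b)| :=
  LipschitzWith.of_dist_le_mul fun u v => by
    simp only [Real.dist_eq, NNReal.coe_one, one_mul]
    refine (abs_abs_sub_abs_le _ _).trans ?_
    rw [sub_sub_sub_cancel_right]
    exact abs_abs_sub_abs_le _ _

lemma exists_lipschitzWith_edgeBump (b η : ℝ) : ∃ K, LipschitzWith K (edgeBump b η) := by
  have h1 := (lipschitzWith_smul (1 / (4 * η))).comp (lipschitzWith_abs_abs_sub b)
  have h2 := ((LipschitzWith.const (1 : ℝ)).sub h1).const_max 0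
  have he : edgeBump b η = fun u => max 0 (1 - 1 / (4 * η) * |(|u| - b)|) := by
    funext u
    rw [edgeBump, div_mul_eq_mul_div, one_mul]
  rw [he]
  exact ⟨_, h2⟩

lemma exists_lipschitzWith_lipWindow (b η : ℝ) : ∃ K, LipschitzWith K (lipWindow b η) := by
  have h0 : LipschitzWith 1 fun u : ℝ => |u| := lipschitzWith_one_norm
  have h1 := (lipschitzWith_smul (b / (2 * η))).comp
    (((LipschitzWith.const b).sub h0).const_max 0)
  have h2 := h1.neg.max (LipschitzWith.id.min h1)
  exact ⟨_, h2⟩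

lemma abs_lipWindow_le (hb : 0 < b) (hη : 0 < η) (u : ℝ) : |lipWindow b η u| ≤ b := by
  unfold lipWindow
  set τ := b / (2 * η) * max 0 (b - |u|) with hτ
  have hτ0 : 0 ≤ τ := by positivity
  have h1 : |max (-τ) (min u τ)| ≤ |u| := by
    rcases le_total 0 u with h | h
    · rw [abs_of_nonneg h, abs_of_nonneg]
      · exact max_le (by linarith) (min_le_left _ _)
      · exact le_max_of_le_right (le_min h hτ0)
    · rw [abs_of_nonpos h, abs_of_nonpos]
      · linarith [le_max_right (-τ) (min u τ), min_eq_left (h.trans hτ0)]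
      · exact max_le (by linarith) ((min_le_left _ _).trans h)
  rcases le_total |u| b with h | h
  · exact h1.trans h
  · have : τ = 0 := by rw [hτ, max_eq_left (by linarith), mul_zero]
    rw [this]
    have : max (-0) (min u 0) = 0 := by
      rw [neg_zero]; exact max_eq_left (min_le_right _ _)
    rw [this, abs_zero]
    exact hb.le

lemma abs_lipWindow_sub_window_le (hb : 0 < b) (hη : 0 < η) (u : ℝ) :
    |lipWindow b η u - window b u| ≤ 2 * b * edgeBump b η u := by
  have hv := edgeBump_nonneg b η u
  unfold lipWindow
  set τ := b / (2 * η) * max 0 (b - |u|) with hτ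
  have hτ0 : 0 ≤ τ := by positivity
  by_cases h : |u| < b
  · rw [window, if_pos h]
    by_cases h2 : |u| ≤ τ
    · have := abs_le.1 h2
      rw [min_eq_left this.2, max_eq_right this.1, sub_self, abs_zero]
      positivity
    · have hedge : 1 / 2 ≤ edgeBump b η u := by
        refine half_le_edgeBump hη ?_
        rw [abs_of_nonpos (by linarith)]
        have h3 : b / (2 * η) * (b - |u|) < b := by
          rw [hτ, max_eq_right (by linarith)] at h2
          linarith
        rw [div_mul_eq_mul_div, div_lt_iff₀ (by positivity)] at h3
        linarith [lt_of_mul_lt_mul_left h3 hb.le]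
      have h3 : |max (-τ) (min u τ) - u| ≤ |u| := by
        rcases le_total 0 u with h0 | h0
        · have h4 : max (-τ) (min u τ) = min u τ := max_eq_right (by
            have := le_min h0 hτ0; linarith)
          have h5 := le_min h0 hτ0
          rw [h4, abs_of_nonneg h0, abs_le]
          constructor <;> linarith [min_le_left u τ]
        · rw [min_eq_left (h0.trans hτ0), abs_of_nonpos h0, abs_le]
          have h6 : max (-τ) u ≤ 0 := max_le (by linarith) h0
          constructor <;> linarith [le_max_right (-τ) u]
      refine h3.trans (h.le.trans ?_)
      nlinarith
  · have : τ = 0 := by rw [hτ, max_eq_left (by linarith), mul_zero]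
    rw [window, if_neg h, this, neg_zero, max_eq_left (min_le_right _ _), sub_self, abs_zero]
    positivity

/-- Moving the centre and the half-width of the window by at most `η` changes `window` by at
most `η`, except near the edges of the window. -/
lemma abs_window_sub_window_le (hb : 0 < b) (hη : 0 < η) {b' u u' : ℝ} (hu : |u' - u| ≤ η)
    (hb' : |b' - b| ≤ η) :
    |window b' u' - window b u| ≤ η + 2 * (b + η) * edgeBump b η u := by
  have hv := edgeBump_nonneg b η u
  have hu1 : |u'| ≤ |u| + η := by linarith [abs_sub_abs_le_abs_sub u' u]
  have hu2 : |u| ≤ |u'| + η := by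
    have := abs_sub_abs_le_abs_sub u u'
    rw [abs_sub_comm] at this
    linarith
  have hb1 := abs_le.1 hb'
  have hpos : 0 ≤ 2 * (b + η) * edgeBump b η u := by positivity
  unfold window
  split_ifs with h1 h2 h2
  · linarith
  · have hedge : 1 / 2 ≤ edgeBump b η u := half_le_edgeBump hη (by
      rw [abs_le]; constructor <;> linarith)
    rw [sub_zero]
    nlinarith
  · have hedge : 1 / 2 ≤ edgeBump b η u := half_le_edgeBump hη (by
      rw [abs_le]; constructor <;> linarith)
    rw [zero_sub, abs_neg]
    nlinarith
  · rw [sub_self, abs_zero]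
    linarith

end Window

/-! ### Uniform closeness of the statistic to its limit -/

section Uniform

variable {Ω : Type*} [MeasurableSpace Ω] {P : Measure Ω} [IsProbabilityMeasure P]
  {X : ℕ → Ω → ℝ} {μ : Measure ℝ} [IsProbabilityMeasure μ] {r : ℕ → ℝ} {m : ℝ}

lemma integrable_window (μ : Measure ℝ) [IsProbabilityMeasure μ] (b m : ℝ) :
    Integrable (fun x => window b (x - m)) μ :=
  Integrable.of_bound
    ((measurable_window b).comp (measurable_id.sub_const m)).aestronglyMeasurable (max b 0)
    (ae_of_all _ fun x => abs_window_le_max b (x - m))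

lemma exists_integral_edgeBump_le [NullSingletonClass μ] {b : ℝ} (hb : 0 < b) (m : ℝ) {ζ : ℝ}
    (hζ : 0 < ζ) : ∃ η, 0 < η ∧ η ≤ ζ ∧ η ≤ 1 ∧ ∫ x, edgeBump b η (x - m) ∂μ ≤ ζ := by
  have hlim0 : Tendsto (fun n : ℕ => 1 / ((n : ℝ) + 1)) atTop (𝓝 0) :=
    tendsto_one_div_add_atTop_nhds_zero_nat
  have hlim : Tendsto (fun n : ℕ => ∫ x, edgeBump b (1 / ((n : ℝ) + 1)) (x - m) ∂μ) atTop
      (𝓝 (∫ _, (0 : ℝ) ∂μ)) := by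
    refine tendsto_integral_of_dominated_convergence (fun _ => 1) (fun n => ?_)
      (integrable_const _) (fun n => ae_of_all _ fun x => ?_) ?_
    · obtain ⟨K, hK⟩ := exists_lipschitzWith_edgeBump b (1 / ((n : ℝ) + 1))
      exact (hK.continuous.measurable.comp (measurable_id.sub_const m)).aestronglyMeasurable
    · rw [Real.norm_of_nonneg (edgeBump_nonneg _ _ _)]
      exact edgeBump_le_one (by positivity) _
    · have hne : ∀ᵐ x ∂μ, x ≠ m + b ∧ x ≠ m - b :=
        (Measure.ae_ne μ _).and (Measure.ae_ne μ _)
      filter_upwards [hne] with x hx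
      have hpos : 0 < |(|x - m| - b)| := by
        refine abs_pos.2 fun h => ?_
        rcases (abs_eq hb.le).1 (sub_eq_zero.1 h) with h | h
        · exact hx.1 (by linarith)
        · exact hx.2 (by linarith)
      refine tendsto_const_nhds.congr' ?_
      filter_upwards [hlim0.eventually (gt_mem_nhds (show 0 < |(|x - m| - b)| / 4 by positivity))]
        with n hn
      have h0 : (0 : ℝ) < 1 / ((n : ℝ) + 1) := by positivity
      refine (max_eq_left ?_).symm
      rw [sub_nonpos, le_div_iff₀ (by positivity)]
      linarith
  rw [integral_zero] at hlim
  obtain ⟨n, h1, h2⟩ := ((hlim.eventually (gt_mem_nhds hζ)).and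
    (hlim0.eventually (gt_mem_nhds (lt_min hζ one_pos)))).exists
  have h3 := le_min_iff.1 h2.le
  exact ⟨_, by positivity, h3.1, h3.2, h1.le⟩

/-- Near any `b > 0`, the statistic is uniformly close to its limit, up to an exponentially rare
event. -/
lemma UpperConcentration.exists_expRare_near [NullSingletonClass μ] (hconc : UpperConcentration P X μ r)
    (hr : ∀ N, 0 ≤ r N) {t₀ : ℝ} (ht₀ : 0 < t₀)
    (hint : Integrable (fun x => Real.exp (t₀ * |x|)) μ) (hm : ∫ x, x ∂μ = m) {b : ℝ}
    (hb : 0 < b) {γ : ℝ} (hγ : 0 < γ) :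
    ∃ η, 0 < η ∧ ExpRare P r fun N => {ω | ∃ b' ∈ Metric.ball b η,
      γ ≤ |PsiN (fun i => X i ω) N b' - ∫ x, window b' (x - m) ∂μ|} := by
  set ζ := γ / (16 * (b + 1)) with hζ_def
  have hζ : 0 < ζ := by positivity
  obtain ⟨η, hη, hηζ, hη1, hbump⟩ := exists_integral_edgeBump_le (μ := μ) hb m hζ
  refine ⟨η, hη, ?_⟩
  obtain ⟨K₁, hK₁⟩ := exists_lipschitzWith_edgeBump b η
  obtain ⟨K₂, hK₂⟩ := exists_lipschitzWith_lipWindow b η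
  have hsub : LipschitzWith 1 fun x : ℝ => x - m :=
    LipschitzWith.of_dist_le_mul fun x y => by simp
  have hv := hK₁.comp hsub
  have hg := hK₂.comp hsub
  have hvb : ∀ x, |edgeBump b η (x - m)| ≤ 1 := fun x => by
    rw [abs_of_nonneg (edgeBump_nonneg _ _ _)]
    exact edgeBump_le_one hη _
  have hgb : ∀ x, |lipWindow b η (x - m)| ≤ b := fun x => abs_lipWindow_le hb hη _
  have hvi : Integrable (fun x => edgeBump b η (x - m)) μ :=
    Integrable.of_bound hv.continuous.aestronglyMeasurable 1 (ae_of_all _ hvb)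
  have hgi : Integrable (fun x => lipWindow b η (x - m)) μ :=
    Integrable.of_bound hg.continuous.aestronglyMeasurable b (ae_of_all _ hgb)
  have r1 := hconc.expRare_abs_sub hr (u := fun x => x) LipschitzWith.id ht₀ hint hη
  have r2 := hconc.expRare_abs_sub_of_bounded hr hv hvb hζ
  have r3 := hconc.expRare_abs_sub_of_bounded hr hg hgb hζ
  refine ((r1.union hr r2).union hr r3).mono fun N hN ω hω => ?_
  obtain ⟨b', hb', hω⟩ := hω
  by_contra hcon
  simp only [mem_union, mem_ofPred_eq, not_or, not_le, hm, Function.comp] at hcon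
  obtain ⟨⟨hθ, hV⟩, hG⟩ := hcon
  have hN' : (0 : ℝ) < N := by exact_mod_cast hN
  have hbb : |b' - b| ≤ η := (Metric.mem_ball.1 hb').le
  set θ := sampleMean (fun i => X i ω) N with hθ_def
  change |θ - m| < η at hθ
  set V := 1 / (N : ℝ) * ∑ i ∈ Finset.range N, edgeBump b η (X i ω - m)
  set G := 1 / (N : ℝ) * ∑ i ∈ Finset.range N, lipWindow b η (X i ω - m)
  set v := ∫ x, edgeBump b η (x - m) ∂μ
  set g := ∫ x, lipWindow b η (x - m) ∂μ
  have e1 : |PsiN (fun i => X i ω) N b' - G| ≤ η + 4 * (b + η) * V := by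
    rw [PsiN_eq _ hN, ← mul_sub, ← Finset.sum_sub_distrib, one_div, ← div_eq_inv_mul, abs_div,
      abs_of_pos hN', div_le_iff₀ hN']
    refine (Finset.abs_sum_le_sum_abs _ _).trans ?_
    have hterm : ∀ i ∈ Finset.range N,
        |window b' (X i ω - θ) - lipWindow b η (X i ω - m)|
          ≤ η + 4 * (b + η) * edgeBump b η (X i ω - m) := by
      intro i _
      have h1 := abs_window_sub_window_le (u := X i ω - m) (u' := X i ω - θ) hb hη
        (by rw [sub_sub_sub_cancel_left, abs_sub_comm]; exact hθ.le) hbb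
      have h2 := abs_lipWindow_sub_window_le hb hη (X i ω - m)
      rw [abs_sub_comm] at h2
      have h3 := abs_sub_le (window b' (X i ω - θ)) (window b (X i ω - m))
        (lipWindow b η (X i ω - m))
      have h4 := mul_nonneg hη.le (edgeBump_nonneg b η (X i ω - m))
      linarith
    refine (Finset.sum_le_sum hterm).trans (le_of_eq ?_)
    rw [Finset.sum_add_distrib, Finset.sum_const, Finset.card_range, nsmul_eq_mul,
      ← Finset.mul_sum]
    simp only [V]
    field_simp
  have e2 : |g - ∫ x, window b (x - m) ∂μ| ≤ 2 * b * v := by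
    rw [← integral_sub hgi (integrable_window μ b m), ← integral_const_mul]
    exact (abs_integral_le_integral_abs).trans (integral_mono
      (hgi.sub (integrable_window μ b m)).abs (hvi.const_mul _)
      fun x => abs_lipWindow_sub_window_le hb hη (x - m))
  have e3 : |∫ x, window b' (x - m) ∂μ - ∫ x, window b (x - m) ∂μ|
      ≤ η + 2 * (b + η) * v := by
    rw [← integral_sub (integrable_window μ b' m) (integrable_window μ b m)]
    have : ∫ x, (η + 2 * (b + η) * edgeBump b η (x - m)) ∂μ = η + 2 * (b + η) * v := by
      rw [integral_add (integrable_const _) (hvi.const_mul _), integral_const_mul]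
      simp [v]
    rw [← this]
    exact (abs_integral_le_integral_abs).trans (integral_mono
      ((integrable_window μ b' m).sub (integrable_window μ b m)).abs
      ((integrable_const _).add (hvi.const_mul _))
      fun x => abs_window_sub_window_le hb hη (by simpa using hη.le) hbb)
  have hV2 : V ≤ 2 * ζ := by linarith [(abs_lt.1 hV).2]
  have hζγ : 16 * (b + 1) * ζ = γ := by rw [hζ_def]; field_simp
  have hv0 : 0 ≤ v := integral_nonneg fun x => edgeBump_nonneg _ _ _
  have hV0 : 0 ≤ V := mul_nonneg (by positivity)
    (Finset.sum_nonneg fun i _ => edgeBump_nonneg _ _ _)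
  have b1 : 4 * (b + η) * V ≤ 4 * (b + 1) * (2 * ζ) := by gcongr
  have b2 : 2 * b * v ≤ 2 * b * ζ := by gcongr
  have b3 : 2 * (b + η) * v ≤ 2 * (b + 1) * ζ := by gcongr
  rw [abs_sub_comm] at e3
  have t1 := abs_sub_le (PsiN (fun i => X i ω) N b') G (∫ x, window b' (x - m) ∂μ)
  have t2 := abs_sub_le G g (∫ x, window b' (x - m) ∂μ)
  have t3 := abs_sub_le g (∫ x, window b (x - m) ∂μ) (∫ x, window b' (x - m) ∂μ)
  have : 0 < b * ζ := by positivity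
  linarith

/-- The statistic is uniformly close to its limit over `[κ, B]`, up to an exponentially rare
event. -/
theorem UpperConcentration.expRare_uniform [NullSingletonClass μ] (hconc : UpperConcentration P X μ r)
    (hr : ∀ N, 0 ≤ r N) {t₀ : ℝ} (ht₀ : 0 < t₀)
    (hint : Integrable (fun x => Real.exp (t₀ * |x|)) μ) (hm : ∫ x, x ∂μ = m) {κ B : ℝ}
    (hκ : 0 < κ) {γ : ℝ} (hγ : 0 < γ) :
    ExpRare P r fun N => {ω | ∃ b ∈ Icc κ B,
      γ ≤ |PsiN (fun i => X i ω) N b - ∫ x, window b (x - m) ∂μ|} := by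
  have hloc : ∀ b ∈ Icc κ B, ∃ η, 0 < η ∧ ExpRare P r fun N => {ω | ∃ b' ∈ Metric.ball b η,
      γ ≤ |PsiN (fun i => X i ω) N b' - ∫ x, window b' (x - m) ∂μ|} := fun b hb =>
    hconc.exists_expRare_near hr ht₀ hint hm (hκ.trans_le hb.1) hγ
  choose! η hη hrare using hloc
  obtain ⟨s, hs, hcover⟩ := isCompact_Icc.elim_nhds_subcover (fun b => Metric.ball b (η b))
    fun b hb => Metric.ball_mem_nhds b (hη b hb)
  refine (ExpRare.biUnion hr s fun b hb => hrare b (hs b hb)).mono fun N _ ω hω => ?_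
  obtain ⟨b', hb', hle⟩ := hω
  obtain ⟨b, hb, hbb'⟩ := mem_iUnion₂.1 (hcover hb')
  exact mem_iUnion₂.2 ⟨b, hb, b', hbb', hle⟩

end Uniform

/-! ### The type 2 error and almost sure convergence -/

section Error

variable {Ω : Type*} [MeasurableSpace Ω] {P : Measure Ω} [IsProbabilityMeasure P]
  {X : ℕ → Ω → ℝ} {r : ℕ → ℝ}

/-- Uniform closeness of the statistic to its limit bounds the type 2 error: the limit attains
its maximum at some `b`, and the statistic must deviate at this `b` by at least the distance of
the threshold from that maximum. -/
lemma exists_typeTwoError_le {Ψ : ℝ → ℝ} {κ B : ℝ} (hκ : 0 < κ) (hκB : κ < B)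
    (hΨ : Continuous Ψ)
    (hrare : ∀ γ : ℝ, 0 < γ → ExpRare P r fun N => {ω | ∃ b ∈ Icc κ B,
      γ ≤ |PsiN (fun i => X i ω) N b - Ψ b|}) :
    ∃ (L₁ : ℝ) (L₂ : ℝ → ℝ), 0 < L₁ ∧ (∀ δ, 0 < δ → 0 < L₂ δ) ∧
      ∀ C : ℝ, 0 < C → C < maxAbs Ψ κ B → ∀ N : ℕ, 1 ≤ N →
        P.real {ω | maxAbs (PsiN (fun i => X i ω) N) κ B ≤ C}
          ≤ L₁ * Real.exp (-L₂ (maxAbs Ψ κ B - C) * r N) := by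
  choose! L₂ hL₂ hb using fun γ hγ => (hrare γ hγ).exists_two_mul
  refine ⟨2, L₂, two_pos, hL₂, fun C _ hC N hN => ?_⟩
  refine le_trans (measureReal_mono fun ω hω => ?_) (hb _ (sub_pos.2 hC) N hN)
  obtain ⟨b, hbmem, hbmax⟩ := isCompact_Icc.exists_sSup_image_eq
    (nonempty_Icc.2 hκB.le) (hΨ.abs.continuousOn (s := Icc κ B))
  refine ⟨b, hbmem, ?_⟩
  have hω' : maxAbs (PsiN (fun i => X i ω) N) κ B ≤ C := hω
  have h1 : |PsiN (fun i => X i ω) N b| ≤ C := by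
    refine le_trans (le_csSup ⟨B, ?_⟩
      (mem_image_of_mem (fun b => |PsiN (fun i => X i ω) N b|) hbmem)) hω'
    rintro _ ⟨b', hb', rfl⟩
    exact abs_PsiN_le _ hN hb'.2 (by linarith)
  have h2 : maxAbs Ψ κ B = |Ψ b| := hbmax
  rw [h2, abs_sub_comm]
  linarith [abs_sub_abs_le_abs_sub (Ψ b) (PsiN (fun i => X i ω) N b)]

lemma ae_eventually_uniform {Ψ : ℝ → ℝ} {κ B : ℝ} (hr : ∀ N : ℕ, √(N : ℝ) ≤ r N)
    (hrare : ∀ γ : ℝ, 0 < γ → ExpRare P r fun N => {ω | ∃ b ∈ Icc κ B,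
      γ ≤ |PsiN (fun i => X i ω) N b - Ψ b|}) :
    ∀ᵐ ω ∂P, ∀ γ : ℝ, 0 < γ → ∀ᶠ N in atTop, ∀ b ∈ Icc κ B,
      |PsiN (fun i => X i ω) N b - Ψ b| < γ := by
  have h : ∀ k : ℕ, ∀ᵐ ω ∂P, ∀ᶠ N in atTop, ω ∉ {ω | ∃ b ∈ Icc κ B,
      1 / ((k : ℝ) + 1) ≤ |PsiN (fun i => X i ω) N b - Ψ b|} := fun k =>
    (hrare _ (by positivity)).ae_eventually_notMem hr
  filter_upwards [ae_all_iff.2 h] with ω hω γ hγ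
  obtain ⟨k, hk⟩ := exists_nat_one_div_lt hγ
  filter_upwards [hω k] with N hN b hb
  by_contra hcon
  exact hN ⟨b, hb, hk.le.trans (not_lt.1 hcon)⟩

lemma UpperConcentration.ae_tendsto_sampleMean {μ : Measure ℝ} [IsProbabilityMeasure μ]
    (hconc : UpperConcentration P X μ r) (hr : ∀ N : ℕ, √(N : ℝ) ≤ r N) {t₀ : ℝ}
    (ht₀ : 0 < t₀) (hint : Integrable (fun x => Real.exp (t₀ * |x|)) μ) :
    ∀ᵐ ω ∂P, Tendsto (fun N => sampleMean (fun i => X i ω) N) atTop (𝓝 (∫ x, x ∂μ)) := by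
  have h : ∀ k : ℕ, ∀ᵐ ω ∂P, ∀ᶠ N : ℕ in atTop, ω ∉ {ω | 1 / ((k : ℝ) + 1)
      ≤ |1 / (N : ℝ) * ∑ i ∈ Finset.range N, X i ω - ∫ x, x ∂μ|} := fun k =>
    (hconc.expRare_abs_sub (fun N => (Real.sqrt_nonneg _).trans (hr N)) (u := fun x => x)
      LipschitzWith.id ht₀ hint (by positivity)).ae_eventually_notMem hr
  filter_upwards [ae_all_iff.2 h] with ω hω
  refine Metric.tendsto_nhds.2 fun γ hγ => ?_
  obtain ⟨k, hk⟩ := exists_nat_one_div_lt hγ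
  filter_upwards [hω k] with N hN
  exact lt_of_lt_of_le (not_le.1 hN) hk.le

end Error

/-! ### The limit function -/

section Limit

variable {f : ℝ → ℝ} {m : ℝ}

lemma PsiLim_eq_sub (hf : Continuous f) (b : ℝ) :
    PsiLim f m b = (∫ x in (0)..(m + b), f x * (x - m)) - ∫ x in (0)..(m - b), f x * (x - m) := by
  have hi : ∀ a c, IntervalIntegrable (fun x => f x * (x - m)) volume a c := fun a c =>
    Continuous.intervalIntegrable (by fun_prop) a c
  rw [intervalIntegral.integral_interval_sub_left (hi _ _) (hi _ _), PsiLim, rFun, dFun,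
    ← intervalIntegral.integral_const_mul, ← intervalIntegral.integral_sub
      (Continuous.intervalIntegrable (by fun_prop) _ _)
      (Continuous.intervalIntegrable (by fun_prop) _ _)]
  refine intervalIntegral.integral_congr fun x _ => ?_
  ring

lemma hasDerivAt_PsiLim (hf : Continuous f) (b : ℝ) :
    HasDerivAt (PsiLim f m) (b * (f (m + b) - f (m - b))) b := by
  have hF : Continuous fun x => f x * (x - m) := by fun_prop
  have hd : ∀ y, HasDerivAt (fun y => ∫ x in (0)..y, f x * (x - m)) (f y * (y - m)) y := fun y =>
    intervalIntegral.integral_hasDerivAt_right (hF.intervalIntegrable _ _)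
      (hF.stronglyMeasurableAtFilter _ _) hF.continuousAt
  have h1 := (hd (m + b)).comp_const_add m b
  have h2 := (hd (m - b)).comp_const_sub m b
  have h3 := h1.sub h2
  have he : PsiLim f m = (fun b => (∫ x in (0)..(m + b), f x * (x - m)))
      - fun b => ∫ x in (0)..(m - b), f x * (x - m) := funext fun b => PsiLim_eq_sub hf b
  rw [he]
  exact h3.congr_deriv (by ring)

lemma integral_withDensity_ofReal (hf : Measurable f) (h0 : ∀ x, 0 ≤ f x) (g : ℝ → ℝ) :
    ∫ x, g x ∂(volume.withDensity fun x => ENNReal.ofReal (f x)) = ∫ x, f x * g x := by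
  rw [integral_withDensity_eq_integral_toReal_smul (by fun_prop)
    (ae_of_all _ fun x => ENNReal.ofReal_lt_top)]
  refine integral_congr_ae (ae_of_all _ fun x => ?_)
  simp only [ENNReal.toReal_ofReal (h0 x), smul_eq_mul]

lemma PsiLim_eq_integral_window (hf : Continuous f) (h0 : ∀ x, 0 ≤ f x) {b : ℝ} (hb : 0 ≤ b) :
    PsiLim f m b
      = ∫ x, window b (x - m) ∂(volume.withDensity fun x => ENNReal.ofReal (f x)) := by
  rw [integral_withDensity_ofReal hf.measurable h0, PsiLim_eq_sub hf,
    intervalIntegral.integral_interval_sub_left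
      (Continuous.intervalIntegrable (by fun_prop) _ _)
      (Continuous.intervalIntegrable (by fun_prop) _ _),
    intervalIntegral.integral_of_le (by linarith), integral_Ioc_eq_integral_Ioo,
    ← integral_indicator measurableSet_Ioo]
  refine integral_congr_ae (ae_of_all _ fun x => ?_)
  by_cases hx : |x - m| < b
  · have hx' := abs_lt.1 hx
    have hmem : x ∈ Ioo (m - b) (m + b) := ⟨by linarith, by linarith⟩
    simp [window, hx, indicator_of_mem hmem]
  · have hmem : x ∉ Ioo (m - b) (m + b) := fun h =>
      hx (abs_lt.2 ⟨by linarith [h.1], by linarith [h.2]⟩)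
    simp [window, hx, indicator_of_notMem hmem]

lemma tendsto_integral_window {μ : Measure ℝ} [IsProbabilityMeasure μ]
    (hint : Integrable (fun x => x) μ) (hm : ∫ x, x ∂μ = m) :
    Tendsto (fun n : ℕ => ∫ x, window n (x - m) ∂μ) atTop (𝓝 0) := by
  have hi : Integrable (fun x => x - m) μ := hint.sub (integrable_const _)
  have h0 : ∫ x, (x - m) ∂μ = 0 := by
    rw [integral_sub hint (integrable_const _), hm]; simp
  rw [← h0]
  refine tendsto_integral_of_dominated_convergence (fun x => |x - m|)
    (fun n => (integrable_window μ n m).aestronglyMeasurable) hi.abs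
    (fun n => ae_of_all _ fun x => abs_window_le _ _) (ae_of_all _ fun x => ?_)
  refine tendsto_const_nhds.congr' ?_
  filter_upwards [eventually_gt_atTop ⌈|x - m|⌉₊] with n hn
  have h : |x - m| < n := (Nat.le_ceil _).trans_lt (by exact_mod_cast hn)
  rw [window, if_pos h]

end Limit

/-! ### Maximizers and solutions of the estimating equations -/

section Maximum

lemma pos_or_neg_of_ne_zero {D : ℝ → ℝ} (hD : Continuous D) {S : Set ℝ} (hS : IsPreconnected S)
    (hne : ∀ x ∈ S, D x ≠ 0) : (∀ x ∈ S, 0 < D x) ∨ (∀ x ∈ S, D x < 0) := by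
  by_contra! h
  obtain ⟨⟨x, hx, hx0⟩, ⟨y, hy, hy0⟩⟩ := h
  obtain ⟨z, hz, hz0⟩ := hS.intermediate_value hx hy hD.continuousOn ⟨hx0, hy0⟩
  exact hne z hz hz0

/-- A function on `[0, ∞)` that vanishes at `0` and at infinity, with a single critical point
`c` in `(0, ∞)`, has its strict absolute maximum in modulus there. -/
lemma abs_lt_abs_of_unique_critical {Ψ D : ℝ → ℝ} {c : ℝ} (hc : 0 < c)
    (hd : ∀ b, HasDerivAt Ψ (b * D b) b) (hD : Continuous D) (h0 : Ψ 0 = 0)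
    (hlim : Tendsto (fun n : ℕ => Ψ n) atTop (𝓝 0)) (hne : ∀ b, 0 < b → D b = 0 → b = c)
    {b : ℝ} (hb : 0 < b) (hbc : b ≠ c) : |Ψ b| < |Ψ c| := by
  wlog hpos : ∀ x ∈ Ioo 0 c, 0 < D x generalizing Ψ D
  · have hneg := (pos_or_neg_of_ne_zero hD isPreconnected_Ioo
      fun x hx h => hx.2.ne (hne x hx.1 h)).resolve_left hpos
    have h := this (Ψ := fun x => -Ψ x) (D := fun x => -D x)
      (fun b => by rw [mul_neg]; exact (hd b).neg) hD.neg (by simp [h0]) (by simpa using hlim.neg)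
      (fun b hb h => hne b hb (neg_eq_zero.1 h)) (fun x hx => neg_pos.2 (hneg x hx))
    simpa using h
  have hcont : Continuous Ψ := continuous_iff_continuousAt.2 fun b => (hd b).continuousAt
  have hmono : StrictMonoOn Ψ (Icc 0 c) := by
    refine strictMonoOn_of_deriv_pos (convex_Icc _ _) hcont.continuousOn fun x hx => ?_
    rw [interior_Icc] at hx
    rw [(hd x).deriv]
    exact mul_pos hx.1 (hpos x hx)
  have hcpos : 0 < Ψ c := h0 ▸ hmono (left_mem_Icc.2 hc.le) (right_mem_Icc.2 hc.le) hc
  -- `Ψ` cannot increase beyond `c`, since it tends to zero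
  have hneg : ∀ x ∈ Ioi c, D x < 0 := by
    refine (pos_or_neg_of_ne_zero hD isPreconnected_Ioi
      fun x hx h => (ne_of_gt hx) (hne x (hc.trans hx) h)).resolve_left fun hpos' => ?_
    have hmono' : StrictMonoOn Ψ (Ici c) := by
      refine strictMonoOn_of_deriv_pos (convex_Ici _) hcont.continuousOn fun x hx => ?_
      rw [interior_Ici] at hx
      rw [(hd x).deriv]
      exact mul_pos (hc.trans hx) (hpos' x hx)
    have hle : Ψ c ≤ 0 := by
      refine ge_of_tendsto hlim ?_
      filter_upwards [eventually_ge_atTop ⌈c⌉₊] with n hn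
      have hcn : c ≤ n := Nat.ceil_le.1 hn
      exact hmono'.monotoneOn (mem_Ici.2 le_rfl) (mem_Ici.2 hcn) hcn
    linarith
  have hanti : StrictAntiOn Ψ (Ici c) := by
    refine strictAntiOn_of_deriv_neg (convex_Ici _) hcont.continuousOn fun x hx => ?_
    rw [interior_Ici] at hx
    rw [(hd x).deriv]
    exact mul_neg_of_pos_of_neg (hc.trans hx) (hneg x hx)
  rw [abs_of_pos hcpos]
  rcases lt_or_gt_of_ne hbc with h | h
  · have h1 : Ψ b < Ψ c := hmono ⟨hb.le, h.le⟩ (right_mem_Icc.2 hc.le) h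
    have h2 : Ψ 0 < Ψ b := hmono (left_mem_Icc.2 hc.le) ⟨hb.le, h.le⟩ hb
    rw [abs_of_pos (by linarith)]
    exact h1
  · have h1 : Ψ b < Ψ c := hanti (mem_Ici.2 le_rfl) (mem_Ici.2 h.le) h
    have h2 : 0 ≤ Ψ b := by
      refine le_of_tendsto hlim ?_
      filter_upwards [eventually_ge_atTop ⌈b⌉₊] with n hn
      have hbn : b ≤ n := Nat.ceil_le.1 hn
      exact hanti.antitoneOn (mem_Ici.2 h.le) (mem_Ici.2 (h.le.trans hbn)) hbn
    rwa [abs_of_nonneg h2]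

/-- Maximizers of uniformly convergent functions on a compact interval converge to the strict
maximizer of the limit. -/
lemma tendsto_of_isMaxOn {g : ℕ → ℝ → ℝ} {G : ℝ → ℝ} {κ B c : ℝ} (hG : Continuous G)
    (hc : c ∈ Icc κ B) (hmax : ∀ b ∈ Icc κ B, b ≠ c → |G b| < |G c|)
    (hunif : ∀ γ : ℝ, 0 < γ → ∀ᶠ N in atTop, ∀ b ∈ Icc κ B, |g N b - G b| < γ) {bN : ℕ → ℝ}
    (hbN : ∀ᶠ N in atTop, bN N ∈ Icc κ B ∧ IsMaxOn (fun b => |g N b|) (Icc κ B) (bN N)) :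
    Tendsto bN atTop (𝓝 c) := by
  refine Metric.tendsto_nhds.2 fun δ hδ => ?_
  have hS : IsCompact (Icc κ B \ Metric.ball c δ) := isCompact_Icc.diff Metric.isOpen_ball
  rcases (Icc κ B \ Metric.ball c δ).eq_empty_or_nonempty with hempty | hne
  · filter_upwards [hbN] with N hN
    by_contra hcon
    have : bN N ∈ Icc κ B \ Metric.ball c δ := ⟨hN.1, hcon⟩
    rw [hempty] at this
    exact this
  · obtain ⟨a, ha, hamax⟩ := hS.exists_isMaxOn hne hG.abs.continuousOn
    have hac : a ≠ c := fun h => ha.2 (h ▸ Metric.mem_ball_self hδ)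
    have hgap := hmax a ha.1 hac
    filter_upwards [hbN, hunif ((|G c| - |G a|) / 2) (by linarith)] with N hN hu
    by_contra hcon
    have h1 : |G (bN N)| ≤ |G a| := hamax ⟨hN.1, hcon⟩
    have h2 : |g N c| ≤ |g N (bN N)| := hN.2 hc
    have h3 := hu c hc
    have h4 := hu _ hN.1
    rw [abs_sub_comm] at h3
    linarith [abs_sub_abs_le_abs_sub (G c) (g N c), abs_sub_abs_le_abs_sub (g N (bN N)) (G (bN N))]

/-- Solutions of the estimating equations in a compact set converge when the data do, provided
that the limiting equations have only one solution: every cluster point solves the limiting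
equations. -/
lemma tendsto_of_estimatingEq {f₀ : ℝ → ℝ} (hf₀ : Continuous f₀) {θ b : ℕ → ℝ} {θ' b' : ℝ}
    (hθ : Tendsto θ atTop (𝓝 θ')) (hb : Tendsto b atTop (𝓝 b')) {K : Set (ℝ × ℝ)}
    (hK : IsCompact K) (hK0 : ∀ q ∈ K, 0 < q.1) (hne : f₀ (θ' + b') ≠ f₀ (θ' - b'))
    {p : ℝ × ℝ} (huniq : ∀ q ∈ K, EstimatingEq f₀ θ' b' q → q = p) {q : ℕ → ℝ × ℝ}
    (hq : ∀ᶠ N in atTop, q N ∈ K ∧ EstimatingEq f₀ (θ N) (b N) (q N)) :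
    Tendsto q atTop (𝓝 p) := by
  refine hK.tendsto_nhds_of_unique_mapClusterPt (hq.mono fun N h => h.1) fun y hy hcl => ?_
  refine huniq y hy ?_
  obtain ⟨φ, hφ, hlim⟩ := hcl.tendsto_subseq
  have hφt := hφ.tendsto_atTop
  have heq : ∀ᶠ n in atTop, EstimatingEq f₀ (θ (φ n)) (b (φ n)) (q (φ n)) :=
    (hφt.eventually hq).mono fun n h => h.2
  have l1 : Tendsto (fun n => (q (φ n)).1) atTop (𝓝 y.1) := (continuous_fst.tendsto y).comp hlim
  have l2 : Tendsto (fun n => (q (φ n)).2) atTop (𝓝 y.2) := (continuous_snd.tendsto y).comp hlim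
  have lθ : Tendsto (fun n => θ (φ n)) atTop (𝓝 θ') := hθ.comp hφt
  have lb : Tendsto (fun n => b (φ n)) atTop (𝓝 b') := hb.comp hφt
  have lf : ∀ {z : ℕ → ℝ} {z' : ℝ}, Tendsto z atTop (𝓝 z') →
      Tendsto (fun n => f₀ (z n)) atTop (𝓝 (f₀ z')) := fun hz => (hf₀.tendsto _).comp hz
  constructor
  · exact tendsto_nhds_unique ((l1.mul l2).congr' (heq.mono fun n h => h.1)) lθ
  · refine tendsto_nhds_unique
      (((tendsto_const_nhds.sub l1).div l1 (hK0 y hy).ne').congr' (heq.mono fun n h => h.2)) ?_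
    exact ((lf ((lθ.sub lb).sub l2)).sub (lf ((lθ.add lb).sub l2))).div
      ((lf (lθ.add lb)).sub (lf (lθ.sub lb))) (sub_ne_zero.2 hne)

end Maximum

/-! ### The law of the observations -/

section Law

variable {Ω : Type*} [MeasurableSpace Ω] {P : Measure Ω}

lemma UniformCramer.exists_integrable_exp_abs {X : ℕ → Ω → ℝ} (hX : ∀ i, Measurable (X i))
    (hC : UniformCramer P X) {μ : Measure ℝ} (hμ : ∀ i, P.map (X i) = μ) :
    ∃ t₀ : ℝ, 0 < t₀ ∧ Integrable (fun x => Real.exp (t₀ * |x|)) μ := by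
  obtain ⟨T, hT, hi⟩ := hC
  refine ⟨T / 2, half_pos hT, ?_⟩
  have h : ∀ t, |t| < T → Integrable (fun x => Real.exp (t * x)) μ := by
    intro t ht
    rw [← hμ 0, integrable_map_measure (by fun_prop) (hX 0).aemeasurable]
    exact hi 0 t ht
  have hT2 : |T / 2| < T := by rw [abs_of_pos (half_pos hT)]; linarith
  refine ((h (T / 2) hT2).add (h (-(T / 2)) (by rwa [abs_neg]))).mono' (by fun_prop)
    (ae_of_all _ fun x => ?_)
  rw [Real.norm_of_nonneg (Real.exp_pos _).le, Pi.add_apply]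
  rcases abs_cases x with ⟨hx, -⟩ | ⟨hx, -⟩ <;> rw [hx]
  · linarith [Real.exp_pos (-(T / 2) * x)]
  · rw [mul_neg, ← neg_mul]
    linarith [Real.exp_pos (T / 2 * x)]

variable {ε : ℝ} {f₀ f₁ : ℝ → ℝ}

lemma mixture_nonneg (hf₀ : IsDensity f₀) (hf₁ : IsDensity f₁) (hε₀ : 0 < ε) (hε₁ : ε < 1)
    (x : ℝ) : 0 ≤ mixture ε f₀ f₁ x :=
  add_nonneg (mul_nonneg (by linarith) (hf₀.2.1 x)) (mul_nonneg hε₀.le (hf₁.2.1 x))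

/-- The mean of the mixture. Integrability of `x f x` carries over to `x f₀ x` and `x f₁ x`, as
`(1 - ε) f₀ ≤ f` and `ε f₁ ≤ f`. -/
lemma integral_id_mixture (hf₀ : IsDensity f₀) (hf₁ : IsDensity f₁) (hε₀ : 0 < ε) (hε₁ : ε < 1)
    {h : ℝ} (hmean₀ : ∫ x, x * f₀ x = 0) (hmean₁ : ∫ x, x * f₁ x = h)
    (hint : Integrable (fun x => x)
      (volume.withDensity fun x => ENNReal.ofReal (mixture ε f₀ f₁ x))) :
    ∫ x, x ∂(volume.withDensity fun x => ENNReal.ofReal (mixture ε f₀ f₁ x)) = ε * h := by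
  have hm₀ := hf₀.1
  have hm₁ := hf₁.1
  have hmeas : Measurable (mixture ε f₀ f₁) := by unfold mixture; fun_prop
  have h0 := mixture_nonneg hf₀ hf₁ hε₀ hε₁
  have hi : Integrable (fun x => mixture ε f₀ f₁ x * x) := by
    have := (integrable_withDensity_iff_integrable_smul₀' (μ := volume)
      (f := fun x => ENNReal.ofReal (mixture ε f₀ f₁ x)) (by fun_prop)
      (ae_of_all _ fun x => ENNReal.ofReal_lt_top)).1 hint
    simpa only [ENNReal.toReal_ofReal (h0 _), smul_eq_mul] using this
  have h1ε : 0 < 1 - ε := by linarith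
  have hi₀ : Integrable fun x => (1 - ε) * (x * f₀ x) := by
    refine hi.mono (by fun_prop) (ae_of_all _ fun x => ?_)
    have hle : (1 - ε) * f₀ x ≤ mixture ε f₀ f₁ x :=
      le_add_of_nonneg_right (mul_nonneg hε₀.le (hf₁.2.1 x))
    simp only [Real.norm_eq_abs, abs_mul, abs_of_pos h1ε, abs_of_nonneg (hf₀.2.1 x),
      abs_of_nonneg (h0 x)]
    linarith [mul_le_mul_of_nonneg_right hle (abs_nonneg x)]
  have hi₁ : Integrable fun x => ε * (x * f₁ x) := by
    refine hi.mono (by fun_prop) (ae_of_all _ fun x => ?_)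
    have hle : ε * f₁ x ≤ mixture ε f₀ f₁ x :=
      le_add_of_nonneg_left (mul_nonneg h1ε.le (hf₀.2.1 x))
    simp only [Real.norm_eq_abs, abs_mul, abs_of_pos hε₀, abs_of_nonneg (hf₁.2.1 x),
      abs_of_nonneg (h0 x)]
    linarith [mul_le_mul_of_nonneg_right hle (abs_nonneg x)]
  rw [integral_withDensity_ofReal hmeas h0]
  have he : ∀ x, mixture ε f₀ f₁ x * x = (1 - ε) * (x * f₀ x) + ε * (x * f₁ x) := fun x => by
    unfold mixture; ring
  simp only [he]
  rw [integral_add hi₀ hi₁, integral_const_mul, integral_const_mul, hmean₀, hmean₁]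
  ring

end Law

end Contam

theorem theorem2 {Ω : Type*} [MeasurableSpace Ω] (P : Measure Ω) [IsProbabilityMeasure P]
    (X : ℕ → Ω → ℝ) (hX : ∀ i, Measurable (X i))
    (f₀ f₁ : ℝ → ℝ) (hf₀ : Contam.IsDensity f₀) (hf₁ : Contam.IsDensity f₁)
    (ε h κ B : ℝ) (hε₀ : 0 < ε) (hε₁ : ε < 1) (hh : h ≠ 0) (hκ : 0 < κ) (hκB : κ < B)
    (hmean₀ : ∫ x, x * f₀ x = 0) (hmean₁ : ∫ x, x * f₁ x = h)
    -- every observation has the continuous density `f = (1 - ε) f₀ + ε f₁`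
    (hlaw : ∀ i, P.map (X i)
      = volume.withDensity fun x => ENNReal.ofReal (Contam.mixture ε f₀ f₁ x))
    (hcont : Continuous (Contam.mixture ε f₀ f₁))
    (hCramer : Contam.UniformCramer P X) :
    -- 1) the type 2 error under ψ-mixing
    (Contam.PsiMixing P X →
      ∃ (L₁ : ℝ) (L₂ : ℝ → ℝ), 0 < L₁ ∧ (∀ δ, 0 < δ → 0 < L₂ δ) ∧
        ∀ C : ℝ, 0 < C →
          C < Contam.maxAbs (Contam.PsiLim (Contam.mixture ε f₀ f₁) (ε * h)) κ B →
          ∀ N : ℕ, 1 ≤ N →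
            P.real {ω | Contam.maxAbs (Contam.PsiN (fun i => X i ω) N) κ B ≤ C}
              ≤ L₁ * Real.exp (-L₂
                (Contam.maxAbs (Contam.PsiLim (Contam.mixture ε f₀ f₁) (ε * h)) κ B - C) * N))
    ∧
    -- 2) the type 2 error under ψ-weak dependence
    (Contam.PsiWeakDependent P X →
      ∃ (L₁ : ℝ) (L₂ : ℝ → ℝ), 0 < L₁ ∧ (∀ δ, 0 < δ → 0 < L₂ δ) ∧
        ∀ C : ℝ, 0 < C →
          C < Contam.maxAbs (Contam.PsiLim (Contam.mixture ε f₀ f₁) (ε * h)) κ B →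
          ∀ N : ℕ, 1 ≤ N →
            P.real {ω | Contam.maxAbs (Contam.PsiN (fun i => X i ω) N) κ B ≤ C}
              ≤ L₁ * Real.exp (-L₂
                (Contam.maxAbs (Contam.PsiLim (Contam.mixture ε f₀ f₁) (ε * h)) κ B - C)
                  * Real.sqrt N))
    ∧
    -- 3) estimation in the shift model, under either dependence condition
    (Contam.PsiMixing P X ∨ Contam.PsiWeakDependent P X →
      ε < 1 / 2 → 0 < h → Continuous f₀ → (f₁ = fun x => f₀ (x - h)) →
      ∀ bstar ∈ Icc κ B,
        -- `bstar` is the unique positive root of the balancing equation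
        (∀ b : ℝ, 0 < b →
          (Contam.mixture ε f₀ f₁ (ε * h - b) = Contam.mixture ε f₀ f₁ (ε * h + b)
            ↔ b = bstar)) →
        ∀ bN : ℕ → Ω → ℝ,
          -- `bN` is a maximizer of the statistic
          (∀ N : ℕ, 1 ≤ N → ∀ ω, bN N ω ∈ Icc κ B ∧
            IsMaxOn (fun b => |Contam.PsiN (fun i => X i ω) N b|) (Icc κ B) (bN N ω)) →
          (∀ᵐ ω ∂P, Tendsto (fun N => bN N ω) atTop (𝓝 bstar)) ∧
          -- the estimates of `ε` and `h`, sought in a set `Θ` of admissible parameters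
          (∀ Θ : Set (ℝ × ℝ), Θ ⊆ Ioo 0 (1 / 2) ×ˢ Ioi 0 →
            (∀ q ∈ Θ, Contam.EstimatingEq f₀ (ε * h) bstar q → q = (ε, h)) →
            f₀ (ε * h + bstar) ≠ f₀ (ε * h - bstar) →
            ∀ (εhat hhat : ℕ → Ω → ℝ),
              (∀ᵐ ω ∂P, ∃ K ⊆ Θ, IsCompact K ∧ ∀ᶠ N in atTop, (εhat N ω, hhat N ω) ∈ K ∧
                Contam.EstimatingEq f₀ (Contam.sampleMean (fun i => X i ω) N) (bN N ω)
                  (εhat N ω, hhat N ω)) →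
              ∀ᵐ ω ∂P, Tendsto (fun N => εhat N ω) atTop (𝓝 ε) ∧
                Tendsto (fun N => hhat N ω) atTop (𝓝 h))) := by
 
  set f := Contam.mixture ε f₀ f₁ with hf
  set μ := (volume : Measure ℝ).withDensity fun x => ENNReal.ofReal (f x) with hμ
  have hf0 : ∀ x, 0 ≤ f x := Contam.mixture_nonneg hf₀ hf₁ hε₀ hε₁
  have hprob : IsProbabilityMeasure μ :=
    hlaw 0 ▸ Measure.isProbabilityMeasure_map (hX 0).aemeasurable
  obtain ⟨t₀, ht₀, hint⟩ := hCramer.exists_integrable_exp_abs hX hlaw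
  have hint1 : Integrable (fun x => x) μ :=
    Contam.integrable_of_integrable_exp measurable_id ht₀ hint
  have hm : ∫ x, x ∂μ = ε * h :=
    Contam.integral_id_mixture hf₀ hf₁ hε₀ hε₁ hmean₀ hmean₁ hint1
  have hderiv := fun b => Contam.hasDerivAt_PsiLim (m := ε * h) hcont b
  have hΨ : Continuous (Contam.PsiLim f (ε * h)) :=
    continuous_iff_continuousAt.2 fun b => (hderiv b).continuousAt
  have hrare : ∀ r : ℕ → ℝ, Contam.UpperConcentration P X μ r → (∀ N, 0 ≤ r N) →
      ∀ γ : ℝ, 0 < γ → Contam.ExpRare P r fun N => {ω | ∃ b ∈ Icc κ B,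
        γ ≤ |Contam.PsiN (fun i => X i ω) N b - Contam.PsiLim f (ε * h) b|} := by
    intro r hconc hr γ hγ
    refine (hconc.expRare_uniform hr ht₀ hint hm hκ hγ (B := B)).mono fun N _ ω hω => ?_
    obtain ⟨b, hb, hle⟩ := hω
    refine ⟨b, hb, ?_⟩
    rwa [← Contam.PsiLim_eq_integral_window hcont hf0 (hκ.le.trans hb.1)]
  have hmixing := Contam.upperConcentration_of_psiMixing hX hlaw
  have hweak := Contam.upperConcentration_of_psiWeakDependent hX hlaw
  refine ⟨fun hdep => ?_, fun hdep => ?_, ?_⟩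
  · exact Contam.exists_typeTwoError_le hκ hκB hΨ
      (hrare _ (hmixing hdep) fun N => N.cast_nonneg)
  · exact Contam.exists_typeTwoError_le hκ hκB hΨ
      (hrare _ (hweak hdep) fun N => Real.sqrt_nonneg _)
  · intro hdep _ _ hf₀c _ bstar hbstar hroot bN hbN
    obtain ⟨r, hconc, hr⟩ : ∃ r : ℕ → ℝ, Contam.UpperConcentration P X μ r ∧
        ∀ N : ℕ, √(N : ℝ) ≤ r N := by
      rcases hdep with hdep | hdep
      · refine ⟨_, hmixing hdep, fun N => ?_⟩
        rw [Real.sqrt_le_left N.cast_nonneg, sq]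
        exact_mod_cast Nat.le_mul_self N
      · exact ⟨_, hweak hdep, fun N => le_rfl⟩
    have hpos : 0 < bstar := hκ.trans_le hbstar.1
    have hmax : ∀ b ∈ Icc κ B, b ≠ bstar →
        |Contam.PsiLim f (ε * h) b| < |Contam.PsiLim f (ε * h) bstar| := by
      intro b hb hne
      refine Contam.abs_lt_abs_of_unique_critical hpos hderiv (by fun_prop) ?_ ?_ ?_
        (hκ.trans_le hb.1) hne
      · simp [Contam.PsiLim, Contam.rFun, Contam.dFun]
      · refine (Contam.tendsto_integral_window hint1 hm).congr fun n => ?_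
        rw [Contam.PsiLim_eq_integral_window hcont hf0 n.cast_nonneg]
      · intro b hb h0
        exact (hroot b hb).1 (sub_eq_zero.1 h0).symm
    have hb : ∀ᵐ ω ∂P, Tendsto (fun N => bN N ω) atTop (𝓝 bstar) := by
      filter_upwards [Contam.ae_eventually_uniform hr
        (hrare r hconc fun N => (Real.sqrt_nonneg _).trans (hr N))] with ω hω
      refine Contam.tendsto_of_isMaxOn hΨ hbstar hmax hω ?_
      filter_upwards [eventually_ge_atTop 1] with N hN
      exact hbN N hN ω
    refine ⟨hb, fun Θ hΘ huniq hne εhat hhat hest => ?_⟩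
    have hθ := hconc.ae_tendsto_sampleMean hr ht₀ hint
    rw [hm] at hθ
    filter_upwards [hb, hθ, hest] with ω hbω hθω hω
    obtain ⟨K, hKΘ, hK, hev⟩ := hω
    have hlim := Contam.tendsto_of_estimatingEq hf₀c hθω hbω hK
      (fun q hq => (hΘ (hKΘ hq)).1.1) hne (fun q hq => huniq q (hKΘ hq)) hev
    exact ⟨(continuous_fst.tendsto _).comp hlim, (continuous_snd.tendsto _).comp hlim⟩
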